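/- **Setting.** Let $n\ge 3$. A spherical doubly warped (DW) spacetime is given, in coordinates $(t,r,\theta_1,\dots,\theta_{n-2})$ with $t$ and $r$ in open sets $I,J\subseteq\mathbb R$, by $$ds^2=-b^2(r)\,dt^2+a^2(t)\left[f_1^2(r)\,dr^2+f_2^2(r)\,d\Omega^2_{n-2}\right],$$ where $a,b,f_1,f_2$ are smooth and positive and $d\Omega_{n-2}^2$ is the metric of the unit sphere $S^{n-2}$ in arbitrary local coordinates $\theta$. Let $\nabla$ be the Levi-Civita connection, $R_{ij}$ the Ricci tensor and $R$ the curvature scalar. Let $u_j$ be the unit timelike covector with $u_t=-b$ and other components zero; for a scalar $X$ put $\dot X=u^k\nabla_kX$, and let $\dot u_j=u^k\nabla_ku_j$. Put $\eta=\dot u_k\dot u^k$, $\varphi=\nabla_ju^j/(n-1)$, $h_{ij}=g_{ij}+u_iu_j$. Assume that $\dot u$ vanishes nowhere (i.e. $b'(r)\neq0$), and put $\tilde X=\frac1\eta\dot u^k\nabla_kX$ and $N_{ij}=h_{ij}-\frac1\eta\dot u_i\dot u_j$. A scalar $X$ is a *perfect 2-scalar* if $\nabla_jX=-u_j\dot X+\dot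 u_jY$ for some scalar $Y$ (then $Y=\tilde X$). A tensor is *rank-2 perfect* if it is a linear combination, with scalar fields as coefficients, of $u_iu_j$, $g_{ij}$, $u_i\dot u_j+\dot u_iu_j$ and $\dot u_i\dot u_j$. A tensor $T_{ij}$ has the *anisotropic fluid form* if $$T_{ij}=\mu\,u_iu_j+P\,h_{ij}+u_iq_j+u_jq_i+\left[N_iN_j-\tfrac{h_{ij}}{n-1}\right](p_r-p_\perp),\qquad P=\tfrac{1}{n-1}p_r+\tfrac{n-2}{n-1}p_\perp,\quad q_j=c\,\dot u_j,$$ where $N_i$ is the unit radial covector ($N_r=a f_1$, other components zero) and $\mu,p_r,p_\perp,c$ are smooth functions of $(t,r)$ only. **Statement.** 1. (Hessian.) If $X$ is a $C^2$ perfect 2-scalar, its Hessian is a rank-2 perfect tensor; explicitly $$\nabla_i\nabla_jX=-\dot X\varphi\,g_{ij}+u_iu_j(\ddot X-\varphi\dot X-\eta\tilde X)-(\dot u_iu_j+u_i\dot u_j)(\tilde{\dot X}-\varphi\tilde X)+\dot u_i\dot u_j\Big(\tilde{\tilde X}+\tilde X\,\frac{\dot u^k\nabla_k\eta}{2\eta^2}\Big)+N_{ij}\,\tilde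 X\,\frac{-\eta+\nabla_p\dot u^p-\frac{1}{2\eta}\dot u^k\nabla_k\eta}{n-2}.$$ 2. (Curvature.) $R$ is a perfect 2-scalar, and $R_{ij}$, $\nabla_i\nabla_jR$ and $\nabla_iR\,\nabla_jR$ are rank-2 perfect tensors. 3. ($f(R)$ field equations.) Let $f$ be a smooth real function on an open set of reals that contains all values of $R$. Each of the geometric terms $f'(R)R_{kl}$, $\;f'''(R)\nabla_kR\nabla_lR$, $\;f''(R)\nabla_k\nabla_lR$, $\;g_{kl}\left[f'''(R)(\nabla R)^2+f''(R)\nabla^2R-\tfrac12f(R)\right]$, and the whole geometric side of the field equations $$f'(R)R_{kl}-\left[f'''(R)\nabla_kR\nabla_lR+f''(R)\nabla_k\nabla_lR\right]+g_{kl}\left[f'''(R)(\nabla R)^2+f''(R)\nabla^2R-\tfrac12f(R)\right]=\kappa T_{kl},$$ has the anisotropic fluid form. Consequently, if $\kappa\ne0$ and $T_{kl}$ satisfies the field equations, then $T_{kl}$ has the anisotropic fluid form and is a rank-2 perfect tensor. -/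

import Mathlib

open scoped ContDiff

noncomputable section

namespace DWGeometry

/-! ### Tensor calculus in a coordinate chart

`ι` is the set of coordinate labels, points of the chart are elements of `ι → ℝ`, and a
metric is given by its matrix of components `g x i j`. -/

variable {ι : Type} [Fintype ι] [DecidableEq ι]

/-- The partial derivative `∂_i F` at `x`. -/
def pd (i : ι) (F : (ι → ℝ) → ℝ) (x : ι → ℝ) : ℝ :=
  fderiv ℝ F x (Pi.single i 1)

/-- The Christoffel symbol `Γ^k_{ij} = ½ g^{kl} (∂_i g_{jl} + ∂_j g_{il} - ∂_l g_{ij})`. -/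
def christoffel (g : (ι → ℝ) → Matrix ι ι ℝ) (x : ι → ℝ) (k i j : ι) : ℝ :=
  (1 / 2) * ∑ l, (g x)⁻¹ k l *
    (pd i (fun y => g y j l) x + pd j (fun y => g y i l) x - pd l (fun y => g y i j) x)

/-- The covariant derivative `∇_i α_j = ∂_i α_j - Γ^k_{ij} α_k` of a covector field. -/
def covD (g : (ι → ℝ) → Matrix ι ι ℝ) (α : (ι → ℝ) → ι → ℝ) (x : ι → ℝ) (i j : ι) : ℝ :=
  pd i (fun y => α y j) x - ∑ k, christoffel g x k i j * α x k

/-- The gradient covector `∇_j X = ∂_j X` of a scalar field. -/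
def grad (X : (ι → ℝ) → ℝ) (x : ι → ℝ) (j : ι) : ℝ := pd j X x

/-- The Hessian `∇_i ∇_j X` of a scalar field. -/
def hessian (g : (ι → ℝ) → Matrix ι ι ℝ) (X : (ι → ℝ) → ℝ) (x : ι → ℝ) (i j : ι) : ℝ :=
  covD g (grad X) x i j

/-- The contraction `g^{ij} α_i β_j` of two covector fields. -/
def dotProd (g : (ι → ℝ) → Matrix ι ι ℝ) (α β : (ι → ℝ) → ι → ℝ) (x : ι → ℝ) : ℝ :=
  ∑ i, ∑ j, (g x)⁻¹ i j * α x i * β x j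

/-- The trace `g^{ij} T_{ij}` of a 2-tensor field. -/
def trace (g : (ι → ℝ) → Matrix ι ι ℝ) (T : (ι → ℝ) → ι → ι → ℝ) (x : ι → ℝ) : ℝ :=
  ∑ i, ∑ j, (g x)⁻¹ i j * T x i j

/-- The Ricci tensor
`R_{ij} = ∂_m Γ^m_{ij} - ∂_i Γ^m_{mj} + Γ^k_{ij} Γ^m_{km} - Γ^k_{im} Γ^m_{kj}`. -/
def ricci (g : (ι → ℝ) → Matrix ι ι ℝ) (x : ι → ℝ) (i j : ι) : ℝ :=
  ∑ m, pd m (fun y => christoffel g y m i j) x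
    - ∑ m, pd i (fun y => christoffel g y m m j) x
    + ∑ m, ∑ k, christoffel g x k i j * christoffel g x m k m
    - ∑ m, ∑ k, christoffel g x k i m * christoffel g x m k j

/-- The curvature scalar `R = g^{ij} R_{ij}`. -/
def scalarCurv (g : (ι → ℝ) → Matrix ι ι ℝ) (x : ι → ℝ) : ℝ :=
  trace g (ricci g) x

end DWGeometry

open DWGeometry

/-! ### Spherical doubly warped spacetimes -/

/-- Labels of the coordinates `(t, r, θ_1, …, θ_N)`. -/
abbrev DWIdx (N : ℕ) : Type := Fin 2 ⊕ Fin N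

/-- The data of the spherical doubly warped metric
`ds² = -b(r)² dt² + a(t)² [f₁(r)² dr² + f₂(r)² dΩ_N²]` in dimension `n = N + 2`, in a chart
`(t, r, θ)`. The coordinates `θ` are arbitrary local coordinates of the unit sphere
`S^N ⊂ ℝ^(N+1)`: the map `σ` is the immersion that sends `θ` to the point of the sphere, and
`dΩ_N²` is the metric that the sphere inherits from the Euclidean space. -/
structure SphericalDW (N : ℕ) where
  /-- range of the time coordinate -/
  I : Set ℝ
  /-- range of the radial coordinate -/
  J : Set ℝ
  /-- range of the angular coordinates -/
  Θ : Set (Fin N → ℝ)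
  a : ℝ → ℝ
  b : ℝ → ℝ
  f₁ : ℝ → ℝ
  f₂ : ℝ → ℝ
  /-- local parametrization of the unit sphere -/
  σ : (Fin N → ℝ) → EuclideanSpace ℝ (Fin (N + 1))
  isOpen_I : IsOpen I
  isOpen_J : IsOpen J
  isOpen_Θ : IsOpen Θ
  smooth_a : ContDiffOn ℝ ∞ a I
  smooth_b : ContDiffOn ℝ ∞ b J
  smooth_f₁ : ContDiffOn ℝ ∞ f₁ J
  smooth_f₂ : ContDiffOn ℝ ∞ f₂ J
  smooth_σ : ContDiffOn ℝ ∞ σ Θ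
  a_pos : ∀ t ∈ I, 0 < a t
  b_pos : ∀ r ∈ J, 0 < b r
  f₁_pos : ∀ r ∈ J, 0 < f₁ r
  f₂_pos : ∀ r ∈ J, 0 < f₂ r
  norm_σ : ∀ θ ∈ Θ, ‖σ θ‖ = 1
  immersion_σ : ∀ θ ∈ Θ, Function.Injective (fderiv ℝ σ θ)

namespace SphericalDW

variable {N : ℕ} (S : SphericalDW N)

/-- The time coordinate of a point. -/
def tc (x : DWIdx N → ℝ) : ℝ := x (Sum.inl 0)

/-- The radial coordinate of a point. -/
def rc (x : DWIdx N → ℝ) : ℝ := x (Sum.inl 1)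

/-- The angular coordinates of a point. -/
def ac (x : DWIdx N → ℝ) : Fin N → ℝ := fun c => x (Sum.inr c)

/-- The coordinate domain. -/
def domain : Set (DWIdx N → ℝ) := {x | tc x ∈ S.I ∧ rc x ∈ S.J ∧ ac x ∈ S.Θ}

/-- The components of `dΩ_N²`. -/
def sphereMetric (θ : Fin N → ℝ) (c d : Fin N) : ℝ :=
  inner ℝ (fderiv ℝ S.σ θ (Pi.single c 1)) (fderiv ℝ S.σ θ (Pi.single d 1))

/-- The components `g_{ij}` of the spacetime metric. -/
def metric (x : DWIdx N → ℝ) : Matrix (DWIdx N) (DWIdx N) ℝ :=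
  Matrix.fromBlocks
    (Matrix.diagonal ![-(S.b (rc x)) ^ 2, (S.a (tc x)) ^ 2 * (S.f₁ (rc x)) ^ 2])
    0 0
    (Matrix.of fun c d => (S.a (tc x)) ^ 2 * (S.f₂ (rc x)) ^ 2 * S.sphereMetric (ac x) c d)

/-- The velocity covector `u_j`: `u_t = -b`, the other components vanish. -/
def u (x : DWIdx N → ℝ) (j : DWIdx N) : ℝ :=
  if j = Sum.inl 0 then -S.b (rc x) else 0

/-- The unit radial covector `N_j`: `N_r = a f₁`, the other components vanish. -/
def radial (x : DWIdx N → ℝ) (j : DWIdx N) : ℝ :=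
  if j = Sum.inl 1 then S.a (tc x) * S.f₁ (rc x) else 0

/-- The derivative along the velocity, `Ẋ = u^k ∇_k X`. -/
def dot (X : (DWIdx N → ℝ) → ℝ) (x : DWIdx N → ℝ) : ℝ :=
  dotProd S.metric S.u (grad X) x

/-- The acceleration covector `u̇_j = u^k ∇_k u_j`. -/
def acc (x : DWIdx N → ℝ) (j : DWIdx N) : ℝ :=
  ∑ k, ∑ l, (S.metric x)⁻¹ k l * S.u x l * covD S.metric S.u x k j

/-- `η = u̇_j u̇^j`. -/
def η (x : DWIdx N → ℝ) : ℝ := dotProd S.metric S.acc S.acc x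

/-- `φ = ∇_j u^j / (n - 1)`. -/
def φ (x : DWIdx N → ℝ) : ℝ := trace S.metric (covD S.metric S.u) x / ((N : ℝ) + 1)

/-- The divergence of the acceleration, `∇_p u̇^p`. -/
def divAcc (x : DWIdx N → ℝ) : ℝ := trace S.metric (covD S.metric S.acc) x

/-- The derivative along the acceleration, `u̇^k ∇_k X`. -/
def accDeriv (X : (DWIdx N → ℝ) → ℝ) (x : DWIdx N → ℝ) : ℝ :=
  dotProd S.metric S.acc (grad X) x

/-- `X̃ = (1/η) u̇^k ∇_k X`. -/
def tilde (X : (DWIdx N → ℝ) → ℝ) (x : DWIdx N → ℝ) : ℝ := S.accDeriv X x / S.η x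

/-- `h_{ij} = g_{ij} + u_i u_j`. -/
def h (x : DWIdx N → ℝ) (i j : DWIdx N) : ℝ := S.metric x i j + S.u x i * S.u x j

/-- The projector `N_{ij} = g_{ij} + u_i u_j - u̇_i u̇_j / η`. -/
def proj (x : DWIdx N → ℝ) (i j : DWIdx N) : ℝ :=
  S.metric x i j + S.u x i * S.u x j - S.acc x i * S.acc x j / S.η x

/-- `X` is a perfect 2-scalar: `∇_j X = -u_j Ẋ + u̇_j Y` for some scalar `Y`. -/
def IsPerfectTwoScalar (X : (DWIdx N → ℝ) → ℝ) : Prop :=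
  ∃ Y : (DWIdx N → ℝ) → ℝ, ∀ x ∈ S.domain, ∀ j,
    grad X x j = -S.u x j * S.dot X x + S.acc x j * Y x

/-- `T` is a (symmetric) rank-2 perfect tensor: a linear combination, with scalar fields as
coefficients, of `u_i u_j`, `g_{ij}`, `u_i u̇_j + u̇_i u_j` and `u̇_i u̇_j`. -/
def IsPerfectTensor (T : (DWIdx N → ℝ) → DWIdx N → DWIdx N → ℝ) : Prop :=
  ∃ A B C D : (DWIdx N → ℝ) → ℝ, ∀ x ∈ S.domain, ∀ i j,
    T x i j = A x * (S.u x i * S.u x j) + B x * S.metric x i j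
      + C x * (S.u x i * S.acc x j + S.acc x i * S.u x j) + D x * (S.acc x i * S.acc x j)

/-- `T` has the form of the energy-momentum tensor of an anisotropic fluid with velocity `u`,
`T_{ij} = μ u_i u_j + P h_{ij} + u_i q_j + u_j q_i + (N_i N_j - h_{ij}/(n-1)) (p_r - p_⊥)`,
with `P = (p_r + (n-2) p_⊥)/(n-1)` and heat flow `q_j = c u̇_j`; the energy density `μ`,
the pressures `p_r`, `p_⊥` and the factor `c` are smooth functions of `t` and `r`. -/
def IsAnisotropicFluid (T : (DWIdx N → ℝ) → DWIdx N → DWIdx N → ℝ) : Prop :=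
  ∃ μ pr pp c : ℝ × ℝ → ℝ,
    ContDiffOn ℝ ∞ μ (S.I ×ˢ S.J) ∧ ContDiffOn ℝ ∞ pr (S.I ×ˢ S.J) ∧
    ContDiffOn ℝ ∞ pp (S.I ×ˢ S.J) ∧ ContDiffOn ℝ ∞ c (S.I ×ˢ S.J) ∧
    ∀ x ∈ S.domain, ∀ i j,
      T x i j = μ (tc x, rc x) * (S.u x i * S.u x j)
        + (pr (tc x, rc x) + (N : ℝ) * pp (tc x, rc x)) / ((N : ℝ) + 1) * S.h x i j
        + (S.u x i * (c (tc x, rc x) * S.acc x j) + S.u x j * (c (tc x, rc x) * S.acc x i))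
        + (S.radial x i * S.radial x j - S.h x i j / ((N : ℝ) + 1))
            * (pr (tc x, rc x) - pp (tc x, rc x))

/-- The Ricci tensor of the spacetime. -/
def ric (x : DWIdx N → ℝ) (i j : DWIdx N) : ℝ := ricci S.metric x i j

/-- The curvature scalar of the spacetime. -/
def R (x : DWIdx N → ℝ) : ℝ := scalarCurv S.metric x

/-- The Hessian `∇_i ∇_j X` on the spacetime. -/
def hess (X : (DWIdx N → ℝ) → ℝ) (x : DWIdx N → ℝ) (i j : DWIdx N) : ℝ :=
  hessian S.metric X x i j

/-- The term `f'(R) R_{kl}` of the field equations. -/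
def ricTerm (f : ℝ → ℝ) (x : DWIdx N → ℝ) (k l : DWIdx N) : ℝ :=
  deriv f (S.R x) * S.ric x k l

/-- The term `f'''(R) (∇_k R) (∇_l R)` of the field equations. -/
def gradTerm (f : ℝ → ℝ) (x : DWIdx N → ℝ) (k l : DWIdx N) : ℝ :=
  iteratedDeriv 3 f (S.R x) * (grad S.R x k * grad S.R x l)

/-- The term `f''(R) ∇_k ∇_l R` of the field equations. -/
def hessTerm (f : ℝ → ℝ) (x : DWIdx N → ℝ) (k l : DWIdx N) : ℝ :=
  iteratedDeriv 2 f (S.R x) * S.hess S.R x k l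

/-- The term `g_{kl} [f'''(R) (∇R)² + f''(R) ∇²R - ½ f(R)]` of the field equations. -/
def metricTerm (f : ℝ → ℝ) (x : DWIdx N → ℝ) (k l : DWIdx N) : ℝ :=
  S.metric x k l *
    (iteratedDeriv 3 f (S.R x) * dotProd S.metric (grad S.R) (grad S.R) x
      + iteratedDeriv 2 f (S.R x) * trace S.metric (S.hess S.R) x
      - (1 / 2) * f (S.R x))

/-- The geometric side of the `f(R)` field equations. -/
def fieldLHS (f : ℝ → ℝ) (x : DWIdx N → ℝ) (k l : DWIdx N) : ℝ :=
  S.ricTerm f x k l - (S.gradTerm f x k l + S.hessTerm f x k l) + S.metricTerm f x k l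

/-- The `f(R)` field equations with source `κ T`. -/
def FieldEquations (f : ℝ → ℝ) (κ : ℝ) (T : (DWIdx N → ℝ) → DWIdx N → DWIdx N → ℝ) : Prop :=
  ∀ x ∈ S.domain, ∀ k l, S.fieldLHS f x k l = κ * T x k l

end SphericalDW

end

/-! The metric is diagonal in `(t, r)`, with an angular block equal to a function of `(t, r)` times
the unit sphere metric `s`. Spherical symmetry should therefore force every tensor built naturally
from it into the same shape: a symmetric `(t, r)` block of functions of `(t, r)`, no mixed
components, and an angular block proportional to `s`. `IsBlockTensor` records this shape, and
`IsRadialScalar` its scalar counterpart.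

Two points carry the curvature statements. First, the Ricci tensor is a block tensor. The
Christoffel symbols reduce to three families `Gam`, `K`, `L` of functions of `(t, r)` and the
Christoffel symbols of the sphere, so only the intrinsic Ricci tensor of the sphere is needed. In
arbitrary coordinates this comes from the immersion `σ`: the Gauss formula splits `∂_c ∂_d σ` into
tangential and normal parts, symmetry of third derivatives gives `gauss_equation`, and its
contraction gives `ricci_sphere`. Second, block tensors are closed under sums, multiplication by
radial scalars, traces (to scalars), and Hessians and gradient squares of radial scalars. So every
term of the field equations is one.

The conclusion is then linear algebra. Since `b' ≠ 0`, `u` and `u̇` are nonzero multiples of `dt`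
and `dr`; with `g` they generate every block tensor (`IsBlockTensor.isPerfectTensor`), and the fluid
coefficients can be read off the components (`IsBlockTensor.isAnisotropicFluid`).

The Hessian formula is separate, because `X` is only `C²` and only its angular gradient is known to
vanish. There both sides are compared component by component (`IsPerfectTwoScalar.hess_eq`). -/

namespace DWGeometry

/-! ### Partial derivatives in a chart -/

section Calculus

variable {ι : Type} [Fintype ι] [DecidableEq ι] {F G : (ι → ℝ) → ℝ} {x : ι → ℝ}

omit [Fintype ι] in
theorem pd_congr (i : ι) (h : F =ᶠ[nhds x] G) : pd i F x = pd i G x := by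
  unfold pd; rw [h.fderiv_eq]

omit [Fintype ι] in
theorem pd_congr_of_eqOn (i : ι) {s : Set (ι → ℝ)} (hs : IsOpen s) (hx : x ∈ s)
    (h : ∀ y ∈ s, F y = G y) : pd i F x = pd i G x :=
  pd_congr i (Filter.eventuallyEq_of_mem (hs.mem_nhds hx) h)

omit [Fintype ι] in
@[simp] theorem pd_const (i : ι) (c : ℝ) : pd i (fun _ => c) x = 0 := by
  simp [pd]

theorem pd_mul (i : ι) (hF : DifferentiableAt ℝ F x) (hG : DifferentiableAt ℝ G x) :
    pd i (fun y => F y * G y) x = pd i F x * G x + F x * pd i G x := by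
  unfold pd; rw [fderiv_fun_mul hF hG]; simp; ring

theorem pd_sum (i : ι) {κ : Type} (s : Finset κ) {H : κ → (ι → ℝ) → ℝ}
    (h : ∀ k ∈ s, DifferentiableAt ℝ (H k) x) :
    pd i (fun y => ∑ k ∈ s, H k y) x = ∑ k ∈ s, pd i (H k) x := by
  unfold pd; rw [fderiv_fun_sum h]; simp

theorem fderiv_fderiv_apply {V E : Type*} [NormedAddCommGroup V] [NormedSpace ℝ V]
    [NormedAddCommGroup E] [NormedSpace ℝ E] {H : V → E} {x : V} (h : ContDiffAt ℝ 2 H x)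
    (v w : V) : fderiv ℝ (fun y => fderiv ℝ H y v) x w = fderiv ℝ (fderiv ℝ H) x w v := by
  have h1 : DifferentiableAt ℝ (fderiv ℝ H) x :=
    (h.fderiv_right (m := 1) (by norm_num)).differentiableAt (by norm_num)
  rw [fderiv_clm_apply h1 (differentiableAt_const v)]
  simp

theorem fderiv_fderiv_comm {V E : Type*} [NormedAddCommGroup V] [NormedSpace ℝ V]
    [NormedAddCommGroup E] [NormedSpace ℝ E] {H : V → E} {x : V} (h : ContDiffAt ℝ 2 H x)
    (v w : V) :
    fderiv ℝ (fun y => fderiv ℝ H y v) x w = fderiv ℝ (fun y => fderiv ℝ H y w) x v := by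
  rw [fderiv_fderiv_apply h, fderiv_fderiv_apply h]
  exact (h.isSymmSndFDerivAt (by simp)) w v

theorem pd_comm (i j : ι) (h : ContDiffAt ℝ 2 F x) : pd i (pd j F) x = pd j (pd i F) x :=
  fderiv_fderiv_comm h _ _

theorem pd_contDiffOn (i : ι) {s : Set (ι → ℝ)} (hs : IsOpen s) {m n : WithTop ℕ∞}
    (h : ContDiffOn ℝ n F s) (hm : m + 1 ≤ n) : ContDiffOn ℝ m (pd i F) s :=
  (h.fderiv_of_isOpen hs hm).clm_apply contDiffOn_const

end Calculus

end DWGeometry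

open DWGeometry

namespace SphericalDW

variable {N : ℕ} (S : SphericalDW N)

/-! ### The unit sphere -/

/-- The coordinate tangent vectors `∂_c σ`. -/
noncomputable def tangent (c : Fin N) (θ : Fin N → ℝ) : EuclideanSpace ℝ (Fin (N + 1)) :=
  fderiv ℝ S.σ θ (Pi.single c 1)

/-- The second derivatives `∂_c ∂_d σ`. -/
noncomputable def tangent₂ (c d : Fin N) (θ : Fin N → ℝ) : EuclideanSpace ℝ (Fin (N + 1)) :=
  fderiv ℝ (S.tangent d) θ (Pi.single c 1)

/-- The metric of the sphere as a matrix field. -/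
noncomputable def sphereMatrix (θ : Fin N → ℝ) : Matrix (Fin N) (Fin N) ℝ :=
  Matrix.of (S.sphereMetric θ)

theorem sphereMetric_eq (θ : Fin N → ℝ) (c d : Fin N) :
    S.sphereMetric θ c d = inner ℝ (S.tangent c θ) (S.tangent d θ) := rfl

theorem sphereMetric_comm (θ : Fin N → ℝ) (c d : Fin N) :
    S.sphereMetric θ c d = S.sphereMetric θ d c := by
  rw [sphereMetric_eq, sphereMetric_eq, real_inner_comm]

theorem contDiffOn_tangent (c : Fin N) : ContDiffOn ℝ ∞ (S.tangent c) S.Θ :=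
  (S.smooth_σ.fderiv_of_isOpen S.isOpen_Θ (by simp)).clm_apply contDiffOn_const

theorem contDiffOn_tangent₂ (c d : Fin N) : ContDiffOn ℝ ∞ (S.tangent₂ c d) S.Θ :=
  ((S.contDiffOn_tangent d).fderiv_of_isOpen S.isOpen_Θ (by simp)).clm_apply contDiffOn_const

theorem contDiffOn_sphereMetric (c d : Fin N) :
    ContDiffOn ℝ ∞ (fun θ => S.sphereMetric θ c d) S.Θ :=
  (S.contDiffOn_tangent c).inner ℝ (S.contDiffOn_tangent d)

variable {S} {θ : Fin N → ℝ} (hθ : θ ∈ S.Θ)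

include hθ

omit hθ in
theorem differentiableAt_of_contDiffOn {V E : Type*} [NormedAddCommGroup V] [NormedSpace ℝ V]
    [NormedAddCommGroup E] [NormedSpace ℝ E] {F : V → E} {s : Set V} {x : V}
    (h : ContDiffOn ℝ ∞ F s) (hs : IsOpen s) (hx : x ∈ s) : DifferentiableAt ℝ F x :=
  (h.contDiffAt (hs.mem_nhds hx)).differentiableAt (by simp)

theorem inner_self_σ : inner ℝ (S.σ θ) (S.σ θ) = (1 : ℝ) := by
  rw [real_inner_self_eq_norm_sq, S.norm_σ θ hθ]; norm_num

/-- Differentiate `⟨σ, σ⟩ = 1`: the position vector is normal to the sphere. -/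
theorem inner_σ_tangent (c : Fin N) : inner ℝ (S.σ θ) (S.tangent c θ) = (0 : ℝ) := by
  have hd := differentiableAt_of_contDiffOn S.smooth_σ S.isOpen_Θ hθ
  have h1 := fderiv_inner_apply ℝ hd hd (Pi.single c 1)
  have h2 : (fun t => inner ℝ (S.σ t) (S.σ t)) =ᶠ[nhds θ] fun _ => (1 : ℝ) :=
    Filter.eventuallyEq_of_mem (S.isOpen_Θ.mem_nhds hθ) fun y hy => inner_self_σ hy
  rw [h2.fderiv_eq, real_inner_comm (S.σ θ)] at h1
  simp at h1
  unfold tangent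
  linarith

/-- Differentiate the orthogonality `⟨σ, ∂_d σ⟩ = 0`. This is the second fundamental form, and the
only place where the curvature of the sphere enters. -/
theorem inner_σ_tangent₂ (c d : Fin N) :
    inner ℝ (S.σ θ) (S.tangent₂ c d θ) = - S.sphereMetric θ c d := by
  have hd := differentiableAt_of_contDiffOn S.smooth_σ S.isOpen_Θ hθ
  have hd' := differentiableAt_of_contDiffOn (S.contDiffOn_tangent d) S.isOpen_Θ hθ
  have h1 := fderiv_inner_apply ℝ hd hd' (Pi.single c 1)
  have h2 : (fun t => inner ℝ (S.σ t) (S.tangent d t)) =ᶠ[nhds θ] fun _ => (0 : ℝ) :=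
    Filter.eventuallyEq_of_mem (S.isOpen_Θ.mem_nhds hθ) fun y hy => inner_σ_tangent hy d
  rw [h2.fderiv_eq] at h1
  simp at h1
  unfold tangent₂
  rw [sphereMetric_eq]
  unfold tangent at *
  linarith

theorem tangent₂_comm (c d : Fin N) : S.tangent₂ c d θ = S.tangent₂ d c θ :=
  fderiv_fderiv_comm ((S.smooth_σ.contDiffAt (S.isOpen_Θ.mem_nhds hθ)).of_le (by norm_cast)) _ _

theorem pd_sphereMetric (m c d : Fin N) :
    pd m (fun y => S.sphereMetric y c d) θ =
      inner ℝ (S.tangent₂ m c θ) (S.tangent d θ) + inner ℝ (S.tangent₂ m d θ) (S.tangent c θ) := by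
  have h1 := fderiv_inner_apply ℝ
    (differentiableAt_of_contDiffOn (S.contDiffOn_tangent c) S.isOpen_Θ hθ)
    (differentiableAt_of_contDiffOn (S.contDiffOn_tangent d) S.isOpen_Θ hθ) (Pi.single m 1)
  unfold pd
  simp only [sphereMetric_eq]
  rw [h1, real_inner_comm, add_comm]
  rfl

theorem linearIndependent_tangent : LinearIndependent ℝ fun c => S.tangent c θ := by
  have h := (Pi.basisFun ℝ (Fin N)).linearIndependent.map' (fderiv ℝ S.σ θ).toLinearMap
    (LinearMap.ker_eq_bot.2 (S.immersion_σ θ hθ))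
  have e : (fun c => S.tangent c θ) = ⇑(fderiv ℝ S.σ θ).toLinearMap ∘ Pi.basisFun ℝ (Fin N) := by
    ext1 c
    simp [tangent]
  rw [e]
  exact h

/-- The matrix is the Gram matrix of linearly independent vectors, hence positive definite. -/
theorem det_sphereMatrix_ne_zero : (S.sphereMatrix θ).det ≠ 0 :=
  (Matrix.posDef_gram_of_linearIndependent (𝕜 := ℝ) (linearIndependent_tangent hθ)).det_pos.ne'

theorem sphereMatrix_mul_inv : S.sphereMatrix θ * (S.sphereMatrix θ)⁻¹ = 1 :=
  Matrix.mul_nonsing_inv _ (isUnit_iff_ne_zero.2 (det_sphereMatrix_ne_zero hθ))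

theorem sphereMatrix_inv_mul : (S.sphereMatrix θ)⁻¹ * S.sphereMatrix θ = 1 :=
  Matrix.nonsing_inv_mul _ (isUnit_iff_ne_zero.2 (det_sphereMatrix_ne_zero hθ))

/-- The vectors `σ` and `∂_c σ` span the Euclidean space. -/
theorem eq_zero_of_inner_eq_zero {v : EuclideanSpace ℝ (Fin (N + 1))}
    (h0 : inner ℝ v (S.σ θ) = (0 : ℝ)) (h : ∀ c, inner ℝ v (S.tangent c θ) = (0 : ℝ)) :
    v = 0 := by
  have hσ : S.σ θ ∉ Submodule.span ℝ (Set.range fun c => S.tangent c θ) := by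
    intro hm
    have : ∀ w ∈ Submodule.span ℝ (Set.range fun c => S.tangent c θ),
        inner ℝ (S.σ θ) w = (0 : ℝ) := by
      intro w hw
      induction hw using Submodule.span_induction with
      | mem x hx => obtain ⟨c, rfl⟩ := hx; exact inner_σ_tangent hθ c
      | zero => simp
      | add x y _ _ hx hy => rw [inner_add_right, hx, hy, add_zero]
      | smul a x _ hx => rw [inner_smul_right, hx, mul_zero]
    have h1 := this _ hm
    rw [inner_self_σ hθ] at h1
    exact one_ne_zero h1
  -- The `N` tangent vectors and the normal `σ` are `N + 1` independent vectors in a space of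
  -- dimension `N + 1`.
  have hspan := ((linearIndependent_tangent hθ).option hσ).span_eq_top_of_card_eq_finrank'
    (by simp)
  have : ∀ w ∈ (⊤ : Submodule ℝ (EuclideanSpace ℝ (Fin (N + 1)))), inner ℝ v w = (0 : ℝ) := by
    intro w hw
    rw [← hspan] at hw
    induction hw using Submodule.span_induction with
    | mem x hx =>
      obtain ⟨c, rfl⟩ := hx
      cases c with
      | none => exact h0
      | some c => exact h c
    | zero => simp
    | add x y _ _ hx hy => rw [inner_add_right, hx, hy, add_zero]
    | smul a x _ hx => rw [inner_smul_right, hx, mul_zero]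
  exact inner_self_eq_zero.1 (this v trivial)

theorem sum_christoffel_mul_sphereMetric (c d f : Fin N) :
    ∑ e, christoffel S.sphereMatrix θ e c d * S.sphereMetric θ e f =
      inner ℝ (S.tangent₂ c d θ) (S.tangent f θ) := by
  -- Koszul's formula for an induced metric: since second derivatives commute, four of the six terms
  -- cancel and the other two coincide.
  have key : ∀ l, pd c (fun y => S.sphereMatrix y d l) θ + pd d (fun y => S.sphereMatrix y c l) θ
      - pd l (fun y => S.sphereMatrix y c d) θ
        = 2 * inner ℝ (S.tangent₂ c d θ) (S.tangent l θ) := by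
    intro l
    simp only [sphereMatrix, Matrix.of_apply, pd_sphereMetric hθ]
    rw [tangent₂_comm hθ d c, tangent₂_comm hθ d l, tangent₂_comm hθ c l]
    ring
  simp only [christoffel, key, Finset.mul_sum, Finset.sum_mul]
  rw [Finset.sum_comm]
  have h2 : ∀ l, ∑ e, 1 / 2 * ((S.sphereMatrix θ)⁻¹ e l *
      (2 * inner ℝ (S.tangent₂ c d θ) (S.tangent l θ))) * S.sphereMetric θ e f
      = (S.sphereMatrix θ * (S.sphereMatrix θ)⁻¹) f l
        * inner ℝ (S.tangent₂ c d θ) (S.tangent l θ) := by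
    intro l
    rw [Matrix.mul_apply, Finset.sum_mul]
    refine Finset.sum_congr rfl fun e _ => ?_
    rw [sphereMetric_comm, sphereMatrix, Matrix.of_apply]
    ring
  simp only [h2, sphereMatrix_mul_inv hθ, Matrix.one_apply]
  simp

/-- The Gauss formula of the unit sphere. -/
theorem gauss_formula (c d : Fin N) :
    S.tangent₂ c d θ =
      ∑ e, christoffel S.sphereMatrix θ e c d • S.tangent e θ - S.sphereMetric θ c d • S.σ θ := by
  -- The difference of the two sides is tested against the frame formed by `σ` and the `∂_f σ`.
  rw [← sub_eq_zero]
  apply eq_zero_of_inner_eq_zero hθ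
  · simp only [inner_sub_left, sum_inner, inner_smul_left]
    rw [real_inner_comm, inner_σ_tangent₂ hθ, inner_self_σ hθ]
    simp [real_inner_comm (S.σ θ), inner_σ_tangent hθ]
  · intro f
    simp only [inner_sub_left, sum_inner, inner_smul_left, inner_σ_tangent hθ]
    simp [← sphereMetric_eq, sum_christoffel_mul_sphereMetric hθ]

/-- Only the first factor is expanded by the Gauss formula. The second stays as it is, so that its
tangential products cancel against the derivative of the metric in `gauss_equation`. -/
theorem inner_tangent₂_tangent₂ (c d m f : Fin N) :
    inner ℝ (S.tangent₂ c d θ) (S.tangent₂ m f θ) =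
      ∑ e, christoffel S.sphereMatrix θ e c d * inner ℝ (S.tangent₂ m f θ) (S.tangent e θ)
        + S.sphereMetric θ c d * S.sphereMetric θ m f := by
  rw [gauss_formula hθ c d]
  simp only [inner_sub_left, sum_inner, inner_smul_left, inner_σ_tangent₂ hθ]
  simp [real_inner_comm]

-- By Cramer's rule the entries are quotients of determinants, polynomial in the entries of the
-- metric, by a nonvanishing determinant.
omit hθ in
theorem contDiffOn_sphereMatrix_inv (c d : Fin N) :
    ContDiffOn ℝ ∞ (fun θ => (S.sphereMatrix θ)⁻¹ c d) S.Θ := by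
  have hdet : ∀ (M : (Fin N → ℝ) → Matrix (Fin N) (Fin N) ℝ),
      (∀ i j, ContDiffOn ℝ ∞ (fun θ => M θ i j) S.Θ) →
      ContDiffOn ℝ ∞ (fun θ => (M θ).det) S.Θ := by
    intro M hM
    simp only [Matrix.det_apply]
    refine ContDiffOn.sum fun p _ => ContDiffOn.const_smul _ ?_
    exact contDiffOn_prod fun i _ => hM _ _
  simp only [Matrix.inv_def, Ring.inverse_eq_inv', Matrix.smul_apply, smul_eq_mul,
    Matrix.adjugate_apply]
  refine ContDiffOn.mul (ContDiffOn.inv (hdet _ fun i j => S.contDiffOn_sphereMetric i j)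
    fun θ hθ => det_sphereMatrix_ne_zero hθ) (hdet _ fun i j => ?_)
  simp only [Matrix.updateRow_apply]
  split_ifs
  · exact contDiffOn_const
  · exact S.contDiffOn_sphereMetric i j

omit hθ in
theorem contDiffOn_sphereChristoffel (e c d : Fin N) :
    ContDiffOn ℝ ∞ (fun θ => christoffel S.sphereMatrix θ e c d) S.Θ := by
  have h : ∀ i j k, ContDiffOn ℝ ∞ (pd i (fun y => S.sphereMatrix y j k)) S.Θ := fun i j k =>
    pd_contDiffOn i S.isOpen_Θ (S.contDiffOn_sphereMetric j k) (by simp)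
  unfold christoffel
  refine contDiffOn_const.mul (ContDiffOn.sum fun l _ => ?_)
  exact (contDiffOn_sphereMatrix_inv e l).mul (((h _ _ _).add (h _ _ _)).sub (h _ _ _))

omit hθ in
theorem sphereChristoffel_comm (e c d : Fin N) :
    christoffel S.sphereMatrix θ e c d = christoffel S.sphereMatrix θ e d c := by
  unfold christoffel
  congr 1
  refine Finset.sum_congr rfl fun l _ => ?_
  rw [add_comm (pd c _ θ)]
  congr 3
  ext y
  exact sphereMetric_comm S y c d

theorem eq_of_sum_mul_sphereMetric {v w : Fin N → ℝ}
    (h : ∀ f, ∑ e, v e * S.sphereMetric θ e f = ∑ e, w e * S.sphereMetric θ e f) : v = w := by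
  have h1 : Matrix.vecMul v (S.sphereMatrix θ) = Matrix.vecMul w (S.sphereMatrix θ) := by
    ext f
    exact h f
  have h2 := congrArg (fun u => Matrix.vecMul u (S.sphereMatrix θ)⁻¹) h1
  simpa [Matrix.vecMul_vecMul, sphereMatrix_mul_inv hθ] using h2

/-- The Gauss equation of the unit sphere. -/
theorem gauss_equation (m c d e : Fin N) :
    pd m (fun y => christoffel S.sphereMatrix y e c d) θ
      + ∑ k, christoffel S.sphereMatrix θ k c d * christoffel S.sphereMatrix θ e m k
      - (if e = m then S.sphereMetric θ c d else 0) =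
    pd c (fun y => christoffel S.sphereMatrix y e m d) θ
      + ∑ k, christoffel S.sphereMatrix θ k m d * christoffel S.sphereMatrix θ e c k
      - (if e = c then S.sphereMetric θ m d else 0) := by
  -- The third derivative `∂_m ∂_c ∂_d σ` is symmetric in `m` and `c`. Its tangential part is found
  -- by differentiating `⟨∂_c ∂_d σ, ∂_f σ⟩ = Γ^e_{cd} s_{ef}`; the Kronecker delta term comes from
  -- the product of the normal components of `∂_c ∂_d σ` and `∂_m ∂_f σ`.
  have main : ∀ m c f, fderiv ℝ (S.tangent₂ c d) θ (Pi.single m 1) =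
      fderiv ℝ (S.tangent₂ m d) θ (Pi.single c 1) ∧
      inner ℝ (fderiv ℝ (S.tangent₂ c d) θ (Pi.single m 1)) (S.tangent f θ) =
      ∑ e, (pd m (fun y => christoffel S.sphereMatrix y e c d) θ
      + ∑ k, christoffel S.sphereMatrix θ k c d * christoffel S.sphereMatrix θ e m k
      - (if e = m then S.sphereMetric θ c d else 0)) * S.sphereMetric θ e f := by
    intro m c f
    constructor
    · exact fderiv_fderiv_comm (((S.contDiffOn_tangent d).contDiffAt
        (S.isOpen_Θ.mem_nhds hθ)).of_le (by norm_cast)) _ _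
    have h1 := fderiv_inner_apply ℝ
      (differentiableAt_of_contDiffOn (S.contDiffOn_tangent₂ c d) S.isOpen_Θ hθ)
      (differentiableAt_of_contDiffOn (S.contDiffOn_tangent f) S.isOpen_Θ hθ) (Pi.single m 1)
    have h2 : pd m (fun y => inner ℝ (S.tangent₂ c d y) (S.tangent f y)) θ =
        pd m (fun y => ∑ e, christoffel S.sphereMatrix y e c d * S.sphereMetric y e f) θ :=
      pd_congr_of_eqOn m S.isOpen_Θ hθ fun y hy => (sum_christoffel_mul_sphereMetric hy c d f).symm
    have hΓ := fun e => differentiableAt_of_contDiffOn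
      (contDiffOn_sphereChristoffel (S := S) e c d) S.isOpen_Θ hθ
    have hs := fun e => differentiableAt_of_contDiffOn
      (S.contDiffOn_sphereMetric e f) S.isOpen_Θ hθ
    rw [pd_sum _ _ fun e _ => (hΓ e).fun_mul (hs e)] at h2
    simp only [pd_mul _ (hΓ _) (hs _), pd_sphereMetric hθ] at h2
    have h3 := inner_tangent₂_tangent₂ hθ c d m f
    change pd m (fun y => inner ℝ (S.tangent₂ c d y) (S.tangent f y)) θ =
      inner ℝ (S.tangent₂ c d θ) (S.tangent₂ m f θ) + _ at h1
    have h4 : ∑ e, (∑ k, christoffel S.sphereMatrix θ k c d * christoffel S.sphereMatrix θ e m k)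
        * S.sphereMetric θ e f = ∑ k, christoffel S.sphereMatrix θ k c d *
          inner ℝ (S.tangent₂ m k θ) (S.tangent f θ) := by
      simp only [← sum_christoffel_mul_sphereMetric hθ, Finset.sum_mul, Finset.mul_sum]
      rw [Finset.sum_comm]
      simp only [mul_assoc]
    simp only [sub_mul, add_mul, Finset.sum_add_distrib, Finset.sum_sub_distrib, mul_add,
      ite_mul, zero_mul, Finset.sum_ite_eq', Finset.mem_univ, if_true, h4] at h2 ⊢
    linarith
  exact congrFun (eq_of_sum_mul_sphereMetric hθ fun f =>
    ((main m c f).2.symm.trans (by rw [(main m c f).1])).trans (main c m f).2) e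

/-- The Ricci tensor of the unit sphere. -/
theorem ricci_sphere (c d : Fin N) :
    ricci S.sphereMatrix θ c d = ((N : ℝ) - 1) * S.sphereMetric θ c d := by
  -- Contract the Gauss equation over `e = m`. The delta terms give `N s_{cd}` on one side and
  -- `s_{cd}` on the other, whence the factor `N - 1`.
  have h := Finset.sum_congr rfl fun m (_ : m ∈ Finset.univ) => gauss_equation hθ m c d m
  simp only [Finset.sum_add_distrib, Finset.sum_sub_distrib] at h
  simp at h
  have e1 : ∑ m, ∑ k, christoffel S.sphereMatrix θ k c d * christoffel S.sphereMatrix θ m k m =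
      ∑ m, ∑ k, christoffel S.sphereMatrix θ k c d * christoffel S.sphereMatrix θ m m k :=
    Finset.sum_congr rfl fun m _ => Finset.sum_congr rfl fun k _ => by
      rw [sphereChristoffel_comm m k m]
  have e2 : ∑ m, ∑ k, christoffel S.sphereMatrix θ k c m * christoffel S.sphereMatrix θ m k d =
      ∑ m, ∑ k, christoffel S.sphereMatrix θ k m d * christoffel S.sphereMatrix θ m c k := by
    rw [Finset.sum_comm]
    exact Finset.sum_congr rfl fun m _ => Finset.sum_congr rfl fun k _ => mul_comm _ _
  unfold ricci
  rw [e1, e2]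
  linarith

end SphericalDW

namespace SphericalDW

variable {N : ℕ} (S : SphericalDW N)

/-! ### Partial derivatives of functions of the separate coordinates -/

/-- The pair of coordinates `(t, r)`. -/
def tr (x : DWIdx N → ℝ) : ℝ × ℝ := (tc x, rc x)

/-- The partial derivatives with respect to `t` and `r`. -/
noncomputable def D (p : Fin 2) (F : ℝ × ℝ → ℝ) (z : ℝ × ℝ) : ℝ :=
  fderiv ℝ F z (![(1, 0), (0, 1)] p)

section

variable {x : DWIdx N → ℝ}

theorem hasFDerivAt_tc : HasFDerivAt (tc (N := N))
    (ContinuousLinearMap.proj (Sum.inl 0) : (DWIdx N → ℝ) →L[ℝ] ℝ) x :=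
  hasFDerivAt_apply _ _

theorem hasFDerivAt_rc : HasFDerivAt (rc (N := N))
    (ContinuousLinearMap.proj (Sum.inl 1) : (DWIdx N → ℝ) →L[ℝ] ℝ) x :=
  hasFDerivAt_apply _ _

theorem hasFDerivAt_ac : HasFDerivAt (ac (N := N))
    (ContinuousLinearMap.pi fun c : Fin N =>
      (ContinuousLinearMap.proj (Sum.inr c) : (DWIdx N → ℝ) →L[ℝ] ℝ)) x :=
  hasFDerivAt_pi.2 fun _ => hasFDerivAt_apply _ _

theorem contDiff_tc : ContDiff ℝ ∞ (tc (N := N)) := contDiff_apply _ _ _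

theorem contDiff_rc : ContDiff ℝ ∞ (rc (N := N)) := contDiff_apply _ _ _

theorem contDiff_tr : ContDiff ℝ ∞ (tr (N := N)) := contDiff_tc.prodMk contDiff_rc

theorem contDiff_ac : ContDiff ℝ ∞ (ac (N := N)) := contDiff_pi.2 fun _ => contDiff_apply _ _ _

theorem pd_comp_tr_inl {F : ℝ × ℝ → ℝ} (hF : DifferentiableAt ℝ F (tr x)) (p : Fin 2) :
    pd (Sum.inl p) (fun y => F (tr y)) x = D p F (tr x) := by
  have h := hF.hasFDerivAt.comp x (hasFDerivAt_tc.prodMk hasFDerivAt_rc)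
  have h' : fderiv ℝ (fun y => F (tr y)) x = _ := h.fderiv
  rw [pd, h', D]
  fin_cases p <;> simp

theorem pd_comp_tr_inr {F : ℝ × ℝ → ℝ} (hF : DifferentiableAt ℝ F (tr x)) (c : Fin N) :
    pd (Sum.inr c) (fun y => F (tr y)) x = 0 := by
  have h := hF.hasFDerivAt.comp x (hasFDerivAt_tc.prodMk hasFDerivAt_rc)
  have h' : fderiv ℝ (fun y => F (tr y)) x = _ := h.fderiv
  rw [pd, h']
  simp only [ContinuousLinearMap.comp_apply, ContinuousLinearMap.prod_apply,
    ContinuousLinearMap.proj_apply, Pi.single_apply, reduceCtorEq, if_false]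
  exact map_zero _

theorem differentiableAt_comp_fst {A : ℝ → ℝ} {z : ℝ × ℝ} (hA : DifferentiableAt ℝ A z.1) :
    DifferentiableAt ℝ (fun z : ℝ × ℝ => A z.1) z :=
  hA.comp z differentiableAt_fst

theorem differentiableAt_comp_snd {B : ℝ → ℝ} {z : ℝ × ℝ} (hB : DifferentiableAt ℝ B z.2) :
    DifferentiableAt ℝ (fun z : ℝ × ℝ => B z.2) z :=
  hB.comp z differentiableAt_snd

theorem D_zero_mul {A B : ℝ → ℝ} {z : ℝ × ℝ} (hA : DifferentiableAt ℝ A z.1)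
    (hB : DifferentiableAt ℝ B z.2) :
    D 0 (fun z => A z.1 * B z.2) z = deriv A z.1 * B z.2 := by
  have h1 : HasFDerivAt (fun z : ℝ × ℝ => A z.1) (deriv A z.1 • ContinuousLinearMap.fst ℝ ℝ ℝ) z :=
    hA.hasDerivAt.comp_hasFDerivAt z hasFDerivAt_fst
  have h2 : HasFDerivAt (fun z : ℝ × ℝ => B z.2) (deriv B z.2 • ContinuousLinearMap.snd ℝ ℝ ℝ) z :=
    hB.hasDerivAt.comp_hasFDerivAt z hasFDerivAt_snd
  have h' : fderiv ℝ (fun z : ℝ × ℝ => A z.1 * B z.2) z = _ := (h1.mul h2).fderiv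
  rw [D, h']
  simp [mul_comm]

theorem D_one_mul {A B : ℝ → ℝ} {z : ℝ × ℝ} (hA : DifferentiableAt ℝ A z.1)
    (hB : DifferentiableAt ℝ B z.2) :
    D 1 (fun z => A z.1 * B z.2) z = A z.1 * deriv B z.2 := by
  have h1 : HasFDerivAt (fun z : ℝ × ℝ => A z.1) (deriv A z.1 • ContinuousLinearMap.fst ℝ ℝ ℝ) z :=
    hA.hasDerivAt.comp_hasFDerivAt z hasFDerivAt_fst
  have h2 : HasFDerivAt (fun z : ℝ × ℝ => B z.2) (deriv B z.2 • ContinuousLinearMap.snd ℝ ℝ ℝ) z :=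
    hB.hasDerivAt.comp_hasFDerivAt z hasFDerivAt_snd
  have h' : fderiv ℝ (fun z : ℝ × ℝ => A z.1 * B z.2) z = _ := (h1.mul h2).fderiv
  rw [D, h']
  simp

theorem pd_comp_ac_inl {C : (Fin N → ℝ) → ℝ} (hC : DifferentiableAt ℝ C (ac x)) (p : Fin 2) :
    pd (Sum.inl p) (fun y => C (ac y)) x = 0 := by
  have h' : fderiv ℝ (fun y => C (ac y)) x = _ := (hC.hasFDerivAt.comp x hasFDerivAt_ac).fderiv
  rw [pd, h']
  have : (ContinuousLinearMap.pi fun c => (ContinuousLinearMap.proj (Sum.inr c) :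
      (DWIdx N → ℝ) →L[ℝ] ℝ)) (Pi.single (Sum.inl p) 1) = 0 := by
    ext c; simp
  rw [ContinuousLinearMap.comp_apply, this, map_zero]

theorem pd_comp_ac_inr {C : (Fin N → ℝ) → ℝ} (hC : DifferentiableAt ℝ C (ac x)) (c : Fin N) :
    pd (Sum.inr c) (fun y => C (ac y)) x = pd c C (ac x) := by
  have h' : fderiv ℝ (fun y => C (ac y)) x = _ := (hC.hasFDerivAt.comp x hasFDerivAt_ac).fderiv
  rw [pd, h', pd]
  have : (ContinuousLinearMap.pi fun c => (ContinuousLinearMap.proj (Sum.inr c) :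
      (DWIdx N → ℝ) →L[ℝ] ℝ)) (Pi.single (Sum.inr c) 1) = Pi.single c 1 := by
    ext d; simp [Pi.single_apply]
  rw [ContinuousLinearMap.comp_apply, this]

theorem differentiableAt_comp_tr {F : ℝ × ℝ → ℝ} (hF : DifferentiableAt ℝ F (tr x)) :
    DifferentiableAt ℝ (fun y => F (tr y)) x :=
  hF.comp x ((contDiff_tr.differentiable (by simp)) x)

theorem differentiableAt_comp_ac {C : (Fin N → ℝ) → ℝ} (hC : DifferentiableAt ℝ C (ac x)) :
    DifferentiableAt ℝ (fun y => C (ac y)) x :=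
  hC.comp x ((contDiff_ac.differentiable (by simp)) x)

theorem pd_mul_comp_inl {F : ℝ × ℝ → ℝ} {C : (Fin N → ℝ) → ℝ}
    (hF : DifferentiableAt ℝ F (tr x)) (hC : DifferentiableAt ℝ C (ac x)) (p : Fin 2) :
    pd (Sum.inl p) (fun y => F (tr y) * C (ac y)) x = D p F (tr x) * C (ac x) := by
  rw [pd_mul _ (differentiableAt_comp_tr hF) (differentiableAt_comp_ac hC), pd_comp_tr_inl hF,
    pd_comp_ac_inl hC, mul_zero, add_zero]

theorem pd_mul_comp_inr {F : ℝ × ℝ → ℝ} {C : (Fin N → ℝ) → ℝ}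
    (hF : DifferentiableAt ℝ F (tr x)) (hC : DifferentiableAt ℝ C (ac x)) (c : Fin N) :
    pd (Sum.inr c) (fun y => F (tr y) * C (ac y)) x = F (tr x) * pd c C (ac x) := by
  rw [pd_mul _ (differentiableAt_comp_tr hF) (differentiableAt_comp_ac hC), pd_comp_tr_inr hF,
    pd_comp_ac_inr hC, zero_mul, zero_add]

end

/-! ### Smoothness -/

theorem isOpen_tr : IsOpen (S.I ×ˢ S.J) := S.isOpen_I.prod S.isOpen_J

theorem isOpen_domain : IsOpen S.domain :=
  (S.isOpen_I.preimage contDiff_tc.continuous).inter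
    ((S.isOpen_J.preimage contDiff_rc.continuous).inter
      (S.isOpen_Θ.preimage contDiff_ac.continuous))

theorem contDiffOn_D (p : Fin 2) {F : ℝ × ℝ → ℝ} (hF : ContDiffOn ℝ ∞ F (S.I ×ˢ S.J)) :
    ContDiffOn ℝ ∞ (D p F) (S.I ×ˢ S.J) :=
  (hF.fderiv_of_isOpen S.isOpen_tr (by simp)).clm_apply contDiffOn_const

theorem contDiffOn_deriv {A : ℝ → ℝ} {s : Set ℝ} (hs : IsOpen s) (hA : ContDiffOn ℝ ∞ A s) :
    ContDiffOn ℝ ∞ (deriv A) s :=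
  hA.deriv_of_isOpen hs (by simp)

theorem contDiffOn_comp_fst {A : ℝ → ℝ} (hA : ContDiffOn ℝ ∞ A S.I) :
    ContDiffOn ℝ ∞ (fun z : ℝ × ℝ => A z.1) (S.I ×ˢ S.J) :=
  hA.comp contDiffOn_fst fun _ hz => hz.1

theorem contDiffOn_comp_snd {B : ℝ → ℝ} (hB : ContDiffOn ℝ ∞ B S.J) :
    ContDiffOn ℝ ∞ (fun z : ℝ × ℝ => B z.2) (S.I ×ˢ S.J) :=
  hB.comp contDiffOn_snd fun _ hz => hz.2

variable {S} {x : DWIdx N → ℝ}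

theorem tr_mem (hx : x ∈ S.domain) : tr x ∈ S.I ×ˢ S.J := ⟨hx.1, hx.2.1⟩

/-! ### The metric, its inverse and the Christoffel symbols -/

@[simp] theorem metric_tt : S.metric x (Sum.inl 0) (Sum.inl 0) = -(S.b (rc x)) ^ 2 := by
  simp [metric]

@[simp] theorem metric_rr :
    S.metric x (Sum.inl 1) (Sum.inl 1) = S.a (tc x) ^ 2 * S.f₁ (rc x) ^ 2 := by
  simp [metric]

@[simp] theorem metric_tr : S.metric x (Sum.inl 0) (Sum.inl 1) = 0 := by simp [metric]

@[simp] theorem metric_rt : S.metric x (Sum.inl 1) (Sum.inl 0) = 0 := by simp [metric]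

@[simp] theorem metric_inl_inr (p : Fin 2) (c : Fin N) :
    S.metric x (Sum.inl p) (Sum.inr c) = 0 := by simp [metric]

@[simp] theorem metric_inr_inl (p : Fin 2) (c : Fin N) :
    S.metric x (Sum.inr c) (Sum.inl p) = 0 := by simp [metric]

@[simp] theorem metric_inr_inr (c d : Fin N) : S.metric x (Sum.inr c) (Sum.inr d) =
    S.a (tc x) ^ 2 * S.f₂ (rc x) ^ 2 * S.sphereMetric (ac x) c d := by simp [metric]

theorem metric_inv (hx : x ∈ S.domain) : (S.metric x)⁻¹ = Matrix.fromBlocks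
    (Matrix.diagonal ![-(S.b (rc x) ^ 2)⁻¹, (S.a (tc x) ^ 2 * S.f₁ (rc x) ^ 2)⁻¹]) 0 0
    ((S.a (tc x) ^ 2 * S.f₂ (rc x) ^ 2)⁻¹ • (S.sphereMatrix (ac x))⁻¹) := by
  have ha := (S.a_pos _ hx.1).ne'
  have hb := (S.b_pos _ hx.2.1).ne'
  have h1 := (S.f₁_pos _ hx.2.1).ne'
  have h2 := (S.f₂_pos _ hx.2.1).ne'
  apply Matrix.inv_eq_right_inv
  have e : (Matrix.of fun c d => S.a (tc x) ^ 2 * S.f₂ (rc x) ^ 2 * S.sphereMetric (ac x) c d) =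
      (S.a (tc x) ^ 2 * S.f₂ (rc x) ^ 2) • S.sphereMatrix (ac x) := by
    ext c d; simp [sphereMatrix]
  rw [metric, e, Matrix.fromBlocks_multiply, Matrix.diagonal_mul_diagonal,
    ← Matrix.fromBlocks_one]
  congr 1
  · ext p q
    fin_cases p <;> fin_cases q <;> simp [-mul_inv_rev, ha, hb, h1]
  · simp
  · simp
  · rw [Matrix.zero_mul, zero_add, Matrix.smul_mul, Matrix.mul_smul,
      sphereMatrix_mul_inv hx.2.2, smul_smul, mul_inv_cancel₀ (by positivity), one_smul]

theorem metric_inv_tt (hx : x ∈ S.domain) :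
    (S.metric x)⁻¹ (Sum.inl 0) (Sum.inl 0) = -(S.b (rc x) ^ 2)⁻¹ := by simp [metric_inv hx]

theorem metric_inv_rr (hx : x ∈ S.domain) : (S.metric x)⁻¹ (Sum.inl 1) (Sum.inl 1) =
    (S.a (tc x) ^ 2 * S.f₁ (rc x) ^ 2)⁻¹ := by simp [metric_inv hx]

theorem metric_inv_tr (hx : x ∈ S.domain) : (S.metric x)⁻¹ (Sum.inl 0) (Sum.inl 1) = 0 := by
  simp [metric_inv hx]

theorem metric_inv_rt (hx : x ∈ S.domain) : (S.metric x)⁻¹ (Sum.inl 1) (Sum.inl 0) = 0 := by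
  simp [metric_inv hx]

theorem metric_inv_inl_inr (hx : x ∈ S.domain) (p : Fin 2) (c : Fin N) :
    (S.metric x)⁻¹ (Sum.inl p) (Sum.inr c) = 0 := by simp [metric_inv hx]

theorem metric_inv_inr_inl (hx : x ∈ S.domain) (p : Fin 2) (c : Fin N) :
    (S.metric x)⁻¹ (Sum.inr c) (Sum.inl p) = 0 := by simp [metric_inv hx]

theorem metric_inv_inr_inr (hx : x ∈ S.domain) (c d : Fin N) :
    (S.metric x)⁻¹ (Sum.inr c) (Sum.inr d) =
      (S.a (tc x) ^ 2 * S.f₂ (rc x) ^ 2)⁻¹ * (S.sphereMatrix (ac x))⁻¹ c d := by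
  simp [metric_inv hx]

variable (S) in
/-- The Christoffel symbols `Γ^p_{qs}` with all indices in the `(t, r)` block. -/
noncomputable def Gam : Fin 2 → Fin 2 → Fin 2 → ℝ × ℝ → ℝ :=
  ![![![fun _ => 0, fun z => deriv S.b z.2 / S.b z.2],
      ![fun z => deriv S.b z.2 / S.b z.2,
        fun z => S.a z.1 * deriv S.a z.1 * (S.f₁ z.2 ^ 2 / S.b z.2 ^ 2)]],
    ![![fun z => (S.a z.1 ^ 2)⁻¹ * (S.b z.2 * deriv S.b z.2 / S.f₁ z.2 ^ 2),
        fun z => deriv S.a z.1 / S.a z.1],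
      ![fun z => deriv S.a z.1 / S.a z.1, fun z => deriv S.f₁ z.2 / S.f₁ z.2]]]

variable (S) in
/-- The factors in `Γ^p_{cd} = K_p s_{cd}`, for the metric `s` of the sphere. -/
noncomputable def K : Fin 2 → ℝ × ℝ → ℝ :=
  ![fun z => S.a z.1 * deriv S.a z.1 * (S.f₂ z.2 ^ 2 / S.b z.2 ^ 2),
    fun z => -(S.f₂ z.2 * deriv S.f₂ z.2 / S.f₁ z.2 ^ 2)]

variable (S) in
/-- The factors in `Γ^e_{pd} = L_p δ^e_d`. -/
noncomputable def L : Fin 2 → ℝ × ℝ → ℝ :=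
  ![fun z => deriv S.a z.1 / S.a z.1, fun z => deriv S.f₂ z.2 / S.f₂ z.2]

section PdMetric

variable (hx : x ∈ S.domain)

include hx

theorem differentiableAt_a : DifferentiableAt ℝ S.a (tc x) :=
  differentiableAt_of_contDiffOn S.smooth_a S.isOpen_I hx.1

theorem differentiableAt_b : DifferentiableAt ℝ S.b (rc x) :=
  differentiableAt_of_contDiffOn S.smooth_b S.isOpen_J hx.2.1

theorem differentiableAt_f₁ : DifferentiableAt ℝ S.f₁ (rc x) :=
  differentiableAt_of_contDiffOn S.smooth_f₁ S.isOpen_J hx.2.1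

theorem differentiableAt_f₂ : DifferentiableAt ℝ S.f₂ (rc x) :=
  differentiableAt_of_contDiffOn S.smooth_f₂ S.isOpen_J hx.2.1

theorem differentiableAt_sphereMetric (c d : Fin N) :
    DifferentiableAt ℝ (fun θ => S.sphereMetric θ c d) (ac x) :=
  differentiableAt_of_contDiffOn (S.contDiffOn_sphereMetric c d) S.isOpen_Θ hx.2.2

-- Every nonzero metric component is a product `A(t) B(r)`, up to the sphere metric, so this one
-- rule serves for the metric and for the kinematic scalars.
omit hx in
theorem pd_comp_mul {A B : ℝ → ℝ} (hA : DifferentiableAt ℝ A (tc x))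
    (hB : DifferentiableAt ℝ B (rc x)) (i : DWIdx N) :
    pd i (fun y => A (tc y) * B (rc y)) x =
      Sum.elim ![deriv A (tc x) * B (rc x), A (tc x) * deriv B (rc x)] (fun _ => 0) i := by
  have hF : DifferentiableAt ℝ (fun z : ℝ × ℝ => A z.1 * B z.2) (tr x) :=
    (differentiableAt_comp_fst hA).fun_mul (differentiableAt_comp_snd hB)
  obtain p | c := i
  · refine (pd_comp_tr_inl hF p).trans ?_
    fin_cases p
    · exact D_zero_mul hA hB
    · exact D_one_mul hA hB
  · exact pd_comp_tr_inr hF c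

theorem pd_metric_tt (i : DWIdx N) : pd i (fun y => -(S.b (rc y)) ^ 2) x =
    Sum.elim ![0, -(2 * S.b (rc x) * deriv S.b (rc x))] (fun _ => 0) i := by
  have hb := differentiableAt_b hx
  have h := pd_comp_mul (A := fun _ => -1) (differentiableAt_const _) (hb.fun_pow 2) i
  simp only [neg_one_mul, deriv_const, zero_mul] at h
  rw [h, deriv_fun_pow hb]
  simp

theorem pd_metric_rr (i : DWIdx N) : pd i (fun y => S.a (tc y) ^ 2 * S.f₁ (rc y) ^ 2) x =
    Sum.elim ![2 * S.a (tc x) * deriv S.a (tc x) * S.f₁ (rc x) ^ 2,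
      S.a (tc x) ^ 2 * (2 * S.f₁ (rc x) * deriv S.f₁ (rc x))] (fun _ => 0) i := by
  have ha := differentiableAt_a hx
  have hf := differentiableAt_f₁ hx
  rw [pd_comp_mul (A := fun t => S.a t ^ 2) (B := fun r => S.f₁ r ^ 2) (ha.fun_pow 2)
    (hf.fun_pow 2) i, deriv_fun_pow ha, deriv_fun_pow hf]
  simp

theorem pd_metric_inr (c d : Fin N) (i : DWIdx N) :
    pd i (fun y => S.a (tc y) ^ 2 * S.f₂ (rc y) ^ 2 * S.sphereMetric (ac y) c d) x =
    Sum.elim ![2 * S.a (tc x) * deriv S.a (tc x) * S.f₂ (rc x) ^ 2 * S.sphereMetric (ac x) c d,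
      S.a (tc x) ^ 2 * (2 * S.f₂ (rc x) * deriv S.f₂ (rc x)) * S.sphereMetric (ac x) c d]
      (fun m => S.a (tc x) ^ 2 * S.f₂ (rc x) ^ 2 *
        pd m (fun θ => S.sphereMetric θ c d) (ac x)) i := by
  have ha := differentiableAt_a hx
  have hf := differentiableAt_f₂ hx
  have hs := differentiableAt_sphereMetric hx c d
  have hF : DifferentiableAt ℝ (fun z : ℝ × ℝ => S.a z.1 ^ 2 * S.f₂ z.2 ^ 2) (tr x) :=
    ((differentiableAt_comp_fst ha).fun_pow 2).fun_mul
      ((differentiableAt_comp_snd hf).fun_pow 2)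
  obtain p | m := i
  · refine (pd_mul_comp_inl hF hs p).trans ?_
    fin_cases p
    · have h := D_zero_mul (z := tr x) (A := fun t => S.a t ^ 2) (B := fun r => S.f₂ r ^ 2)
        (ha.fun_pow 2) (hf.fun_pow 2)
      have h' : deriv (fun t => S.a t ^ 2) (tr x).1 = _ := deriv_fun_pow ha 2
      simp only [Fin.zero_eta, h, h']
      simp [tr]
    · have h := D_one_mul (z := tr x) (A := fun t => S.a t ^ 2) (B := fun r => S.f₂ r ^ 2)
        (ha.fun_pow 2) (hf.fun_pow 2)
      have h' : deriv (fun t => S.f₂ t ^ 2) (tr x).2 = _ := deriv_fun_pow hf 2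
      simp only [Fin.mk_one, h, h']
      simp [tr]
  · exact pd_mul_comp_inr hF hs m

theorem christoffel_inl_inl_inl (p q s : Fin 2) :
    christoffel S.metric x (Sum.inl p) (Sum.inl q) (Sum.inl s) = S.Gam p q s (tr x) := by
  have ha := (S.a_pos _ hx.1).ne'
  have hb := (S.b_pos _ hx.2.1).ne'
  have h1 := (S.f₁_pos _ hx.2.1).ne'
  unfold christoffel
  fin_cases p <;> fin_cases q <;> fin_cases s <;>
  simp [metric_inv_tt hx, metric_inv_rr hx, metric_inv_tr hx, metric_inv_rt hx,
    metric_inv_inl_inr hx, pd_metric_tt hx, pd_metric_rr hx, Gam, tr] <;>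
  field_simp

theorem christoffel_inl_inl_inr (p q : Fin 2) (d : Fin N) :
    christoffel S.metric x (Sum.inl p) (Sum.inl q) (Sum.inr d) = 0 := by
  unfold christoffel
  fin_cases p <;> fin_cases q <;>
  simp [metric_inv_tt hx, metric_inv_rr hx, metric_inv_tr hx, metric_inv_rt hx,
    metric_inv_inl_inr hx, pd_metric_tt hx, pd_metric_rr hx]

theorem christoffel_inl_inr_inl (p q : Fin 2) (d : Fin N) :
    christoffel S.metric x (Sum.inl p) (Sum.inr d) (Sum.inl q) = 0 := by
  unfold christoffel
  fin_cases p <;> fin_cases q <;>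
  simp [metric_inv_tt hx, metric_inv_rr hx, metric_inv_tr hx, metric_inv_rt hx,
    metric_inv_inl_inr hx, pd_metric_tt hx, pd_metric_rr hx]

theorem christoffel_inl_inr_inr (p : Fin 2) (c d : Fin N) :
    christoffel S.metric x (Sum.inl p) (Sum.inr c) (Sum.inr d) =
      S.K p (tr x) * S.sphereMetric (ac x) c d := by
  have ha := (S.a_pos _ hx.1).ne'
  have hb := (S.b_pos _ hx.2.1).ne'
  have h1 := (S.f₁_pos _ hx.2.1).ne'
  unfold christoffel
  fin_cases p <;>
  simp [metric_inv_tt hx, metric_inv_rr hx, metric_inv_tr hx, metric_inv_rt hx,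
    metric_inv_inl_inr hx, pd_metric_inr hx, K, tr] <;>
  field_simp

theorem christoffel_inr_inl_inl (e : Fin N) (p q : Fin 2) :
    christoffel S.metric x (Sum.inr e) (Sum.inl p) (Sum.inl q) = 0 := by
  unfold christoffel
  fin_cases p <;> fin_cases q <;>
  simp [metric_inv_inr_inl hx, pd_metric_tt hx, pd_metric_rr hx]

theorem sum_sphereMatrix_inv_mul (e d : Fin N) :
    ∑ l, (S.sphereMatrix (ac x))⁻¹ e l * S.sphereMetric (ac x) l d = if e = d then 1 else 0 := by
  rw [← Matrix.one_apply, ← sphereMatrix_inv_mul hx.2.2, Matrix.mul_apply]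
  rfl

theorem christoffel_inr_inl_inr (e d : Fin N) (p : Fin 2) :
    christoffel S.metric x (Sum.inr e) (Sum.inl p) (Sum.inr d) =
      if e = d then S.L p (tr x) else 0 := by
  have ha := (S.a_pos _ hx.1).ne'
  have h2 := (S.f₂_pos _ hx.2.1).ne'
  have hs := sum_sphereMatrix_inv_mul hx e d
  -- The Kronecker delta is rewritten as the contraction of `s⁻¹` with `s`, so that both sides
  -- become sums over `l` and can be compared term by term.
  have hL : ∀ w : ℝ, (if e = d then w else 0) = w * if e = d then 1 else 0 := by simp
  rw [hL, ← hs]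
  unfold christoffel
  fin_cases p <;>
  simp only [Fintype.sum_sum_type, Finset.mul_sum] <;>
  simp [metric_inv_inr_inl hx, metric_inv_inr_inr hx, pd_metric_inr hx, L, tr,
    Finset.mul_sum] <;>
  refine Finset.sum_congr rfl fun l _ => ?_ <;>
  rw [S.sphereMetric_comm (ac x) d l] <;> field_simp

theorem christoffel_inr_inr_inl (e d : Fin N) (p : Fin 2) :
    christoffel S.metric x (Sum.inr e) (Sum.inr d) (Sum.inl p) =
      if e = d then S.L p (tr x) else 0 := by
  rw [← christoffel_inr_inl_inr hx]
  unfold christoffel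
  congr 1
  refine Finset.sum_congr rfl fun l _ => ?_
  rw [add_comm (pd (Sum.inr d) _ x)]
  congr 3

theorem christoffel_inr_inr_inr (e c d : Fin N) :
    christoffel S.metric x (Sum.inr e) (Sum.inr c) (Sum.inr d) =
      christoffel S.sphereMatrix (ac x) e c d := by
  have ha := (S.a_pos _ hx.1).ne'
  have h2 := (S.f₂_pos _ hx.2.1).ne'
  unfold christoffel
  simp [metric_inv_inr_inl hx, metric_inv_inr_inr hx, pd_metric_inr hx, sphereMatrix]
  refine Finset.sum_congr rfl fun l _ => ?_
  field_simp

end PdMetric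

end SphericalDW

namespace SphericalDW

variable {N : ℕ} (S : SphericalDW N)

/-! ### Smoothness of the Christoffel symbols -/

section Smooth

theorem contDiffOn_a : ContDiffOn ℝ ∞ (fun z : ℝ × ℝ => S.a z.1) (S.I ×ˢ S.J) :=
  S.contDiffOn_comp_fst S.smooth_a

theorem contDiffOn_b : ContDiffOn ℝ ∞ (fun z : ℝ × ℝ => S.b z.2) (S.I ×ˢ S.J) :=
  S.contDiffOn_comp_snd S.smooth_b

theorem contDiffOn_f₁ : ContDiffOn ℝ ∞ (fun z : ℝ × ℝ => S.f₁ z.2) (S.I ×ˢ S.J) :=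
  S.contDiffOn_comp_snd S.smooth_f₁

theorem contDiffOn_f₂ : ContDiffOn ℝ ∞ (fun z : ℝ × ℝ => S.f₂ z.2) (S.I ×ˢ S.J) :=
  S.contDiffOn_comp_snd S.smooth_f₂

theorem contDiffOn_deriv_a : ContDiffOn ℝ ∞ (fun z : ℝ × ℝ => deriv S.a z.1) (S.I ×ˢ S.J) :=
  S.contDiffOn_comp_fst (contDiffOn_deriv S.isOpen_I S.smooth_a)

theorem contDiffOn_deriv_b : ContDiffOn ℝ ∞ (fun z : ℝ × ℝ => deriv S.b z.2) (S.I ×ˢ S.J) :=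
  S.contDiffOn_comp_snd (contDiffOn_deriv S.isOpen_J S.smooth_b)

theorem contDiffOn_deriv_f₁ : ContDiffOn ℝ ∞ (fun z : ℝ × ℝ => deriv S.f₁ z.2) (S.I ×ˢ S.J) :=
  S.contDiffOn_comp_snd (contDiffOn_deriv S.isOpen_J S.smooth_f₁)

theorem contDiffOn_deriv_f₂ : ContDiffOn ℝ ∞ (fun z : ℝ × ℝ => deriv S.f₂ z.2) (S.I ×ˢ S.J) :=
  S.contDiffOn_comp_snd (contDiffOn_deriv S.isOpen_J S.smooth_f₂)

variable {S}

theorem a_ne_zero {z : ℝ × ℝ} (hz : z ∈ S.I ×ˢ S.J) : S.a z.1 ≠ 0 := (S.a_pos _ hz.1).ne'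

theorem b_ne_zero {z : ℝ × ℝ} (hz : z ∈ S.I ×ˢ S.J) : S.b z.2 ≠ 0 := (S.b_pos _ hz.2).ne'

theorem f₁_ne_zero {z : ℝ × ℝ} (hz : z ∈ S.I ×ˢ S.J) : S.f₁ z.2 ≠ 0 := (S.f₁_pos _ hz.2).ne'

theorem f₂_ne_zero {z : ℝ × ℝ} (hz : z ∈ S.I ×ˢ S.J) : S.f₂ z.2 ≠ 0 := (S.f₂_pos _ hz.2).ne'

variable (S)

theorem contDiffOn_Gam (p q s : Fin 2) : ContDiffOn ℝ ∞ (S.Gam p q s) (S.I ×ˢ S.J) := by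
  have hbb := S.contDiffOn_deriv_b.div S.contDiffOn_b fun _ hz => b_ne_zero hz
  have haa := S.contDiffOn_deriv_a.div S.contDiffOn_a fun _ hz => a_ne_zero hz
  fin_cases p <;> fin_cases q <;> fin_cases s
  · exact contDiffOn_const
  · exact hbb
  · exact hbb
  · exact (S.contDiffOn_a.mul S.contDiffOn_deriv_a).mul
      ((S.contDiffOn_f₁.pow 2).div (S.contDiffOn_b.pow 2) fun _ hz => pow_ne_zero 2 (b_ne_zero hz))
  · exact ((S.contDiffOn_a.pow 2).inv fun _ hz => pow_ne_zero 2 (a_ne_zero hz)).mul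
      ((S.contDiffOn_b.mul S.contDiffOn_deriv_b).div (S.contDiffOn_f₁.pow 2)
        fun _ hz => pow_ne_zero 2 (f₁_ne_zero hz))
  · exact haa
  · exact haa
  · exact S.contDiffOn_deriv_f₁.div S.contDiffOn_f₁ fun _ hz => f₁_ne_zero hz

theorem contDiffOn_K (p : Fin 2) : ContDiffOn ℝ ∞ (S.K p) (S.I ×ˢ S.J) := by
  fin_cases p
  · exact (S.contDiffOn_a.mul S.contDiffOn_deriv_a).mul
      ((S.contDiffOn_f₂.pow 2).div (S.contDiffOn_b.pow 2) fun _ hz => pow_ne_zero 2 (b_ne_zero hz))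
  · exact ((S.contDiffOn_f₂.mul S.contDiffOn_deriv_f₂).div (S.contDiffOn_f₁.pow 2)
        fun _ hz => pow_ne_zero 2 (f₁_ne_zero hz)).neg

theorem contDiffOn_L (p : Fin 2) : ContDiffOn ℝ ∞ (S.L p) (S.I ×ˢ S.J) := by
  fin_cases p
  · exact S.contDiffOn_deriv_a.div S.contDiffOn_a fun _ hz => a_ne_zero hz
  · exact S.contDiffOn_deriv_f₂.div S.contDiffOn_f₂ fun _ hz => f₂_ne_zero hz

theorem Gam_comm (p q s : Fin 2) : S.Gam p q s = S.Gam p s q := by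
  fin_cases p <;> fin_cases q <;> fin_cases s <;> rfl

variable {S}

theorem D_zero_comp_snd {B : ℝ → ℝ} {z : ℝ × ℝ} (hB : DifferentiableAt ℝ B z.2) :
    D 0 (fun z => B z.2) z = 0 := by
  simpa using D_zero_mul (A := fun _ => 1) (differentiableAt_const _) hB

theorem D_one_comp_fst {A : ℝ → ℝ} {z : ℝ × ℝ} (hA : DifferentiableAt ℝ A z.1) :
    D 1 (fun z => A z.1) z = 0 := by
  simpa using D_one_mul (B := fun _ => 1) hA (differentiableAt_const _)

end Smooth

/-! ### The Ricci tensor -/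

variable {S} {x : DWIdx N → ℝ}

section

variable (hx : x ∈ S.domain)

include hx

theorem differentiableAt_tr {F : ℝ × ℝ → ℝ} (hF : ContDiffOn ℝ ∞ F (S.I ×ˢ S.J)) :
    DifferentiableAt ℝ F (tr x) :=
  differentiableAt_of_contDiffOn hF S.isOpen_tr (tr_mem hx)

theorem pd_congr_domain {F G : (DWIdx N → ℝ) → ℝ} (i : DWIdx N)
    (h : ∀ y ∈ S.domain, F y = G y) : pd i F x = pd i G x :=
  pd_congr_of_eqOn i S.isOpen_domain hx h

theorem pd_christoffel_inl_inl_inl (m p q s : Fin 2) :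
    pd (Sum.inl m) (fun y => christoffel S.metric y (Sum.inl p) (Sum.inl q) (Sum.inl s)) x =
      D m (S.Gam p q s) (tr x) :=
  (pd_congr_domain hx _ fun _ hy => christoffel_inl_inl_inl hy p q s).trans
    (pd_comp_tr_inl (differentiableAt_tr hx (S.contDiffOn_Gam p q s)) m)

theorem pd_inr_christoffel_inl_inl_inl (m : Fin N) (p q s : Fin 2) :
    pd (Sum.inr m) (fun y => christoffel S.metric y (Sum.inl p) (Sum.inl q) (Sum.inl s)) x = 0 :=
  (pd_congr_domain hx _ fun _ hy => christoffel_inl_inl_inl hy p q s).trans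
    (pd_comp_tr_inr (differentiableAt_tr hx (S.contDiffOn_Gam p q s)) m)

theorem pd_christoffel_inl_inl_inr (i : DWIdx N) (p q : Fin 2) (d : Fin N) :
    pd i (fun y => christoffel S.metric y (Sum.inl p) (Sum.inl q) (Sum.inr d)) x = 0 :=
  (pd_congr_domain hx _ fun _ hy => christoffel_inl_inl_inr hy p q d).trans (pd_const _ _)

theorem pd_christoffel_inl_inr_inl (i : DWIdx N) (p q : Fin 2) (d : Fin N) :
    pd i (fun y => christoffel S.metric y (Sum.inl p) (Sum.inr d) (Sum.inl q)) x = 0 :=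
  (pd_congr_domain hx _ fun _ hy => christoffel_inl_inr_inl hy p q d).trans (pd_const _ _)

theorem pd_christoffel_inr_inl_inl (i : DWIdx N) (p q : Fin 2) (d : Fin N) :
    pd i (fun y => christoffel S.metric y (Sum.inr d) (Sum.inl p) (Sum.inl q)) x = 0 :=
  (pd_congr_domain hx _ fun _ hy => christoffel_inr_inl_inl hy d p q).trans (pd_const _ _)

theorem pd_christoffel_inl_inr_inr (m p : Fin 2) (c d : Fin N) :
    pd (Sum.inl m) (fun y => christoffel S.metric y (Sum.inl p) (Sum.inr c) (Sum.inr d)) x =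
      D m (S.K p) (tr x) * S.sphereMetric (ac x) c d :=
  (pd_congr_domain hx _ fun _ hy => christoffel_inl_inr_inr hy p c d).trans
    (pd_mul_comp_inl (differentiableAt_tr hx (S.contDiffOn_K p))
      (differentiableAt_sphereMetric hx c d) m)

theorem pd_ite_L (m : Fin 2) (p : Fin 2) (e d : Fin N) :
    pd (Sum.inl m) (fun y => if e = d then S.L p (tr y) else 0) x =
      if e = d then D m (S.L p) (tr x) else 0 := by
  split_ifs
  · exact pd_comp_tr_inl (differentiableAt_tr hx (S.contDiffOn_L p)) m
  · exact pd_const _ _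

theorem pd_inr_ite_L (m : Fin N) (p : Fin 2) (e d : Fin N) :
    pd (Sum.inr m) (fun y => if e = d then S.L p (tr y) else 0) x = 0 := by
  split_ifs
  · exact pd_comp_tr_inr (differentiableAt_tr hx (S.contDiffOn_L p)) m
  · exact pd_const _ _

theorem pd_inr_christoffel_inr_inl_inr (m : Fin N) (p : Fin 2) (e d : Fin N) :
    pd (Sum.inr m) (fun y => christoffel S.metric y (Sum.inr e) (Sum.inl p) (Sum.inr d)) x = 0 :=
  (pd_congr_domain hx _ fun _ hy => christoffel_inr_inl_inr hy e d p).trans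
    (pd_inr_ite_L hx m p e d)

theorem pd_christoffel_inr_inr_inl (m p : Fin 2) (e d : Fin N) :
    pd (Sum.inl m) (fun y => christoffel S.metric y (Sum.inr e) (Sum.inr d) (Sum.inl p)) x =
      if e = d then D m (S.L p) (tr x) else 0 :=
  (pd_congr_domain hx _ fun _ hy => christoffel_inr_inr_inl hy e d p).trans
    (pd_ite_L hx m p e d)

theorem pd_inr_christoffel_inr_inr_inl (m : Fin N) (p : Fin 2) (e d : Fin N) :
    pd (Sum.inr m) (fun y => christoffel S.metric y (Sum.inr e) (Sum.inr d) (Sum.inl p)) x = 0 :=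
  (pd_congr_domain hx _ fun _ hy => christoffel_inr_inr_inl hy e d p).trans
    (pd_inr_ite_L hx m p e d)

theorem pd_christoffel_inr_inr_inr (m : Fin 2) (e c d : Fin N) :
    pd (Sum.inl m) (fun y => christoffel S.metric y (Sum.inr e) (Sum.inr c) (Sum.inr d)) x = 0 :=
  (pd_congr_domain hx _ fun _ hy => christoffel_inr_inr_inr hy e c d).trans
    (pd_comp_ac_inl (C := fun θ => christoffel S.sphereMatrix θ e c d)
      (differentiableAt_of_contDiffOn (contDiffOn_sphereChristoffel e c d) S.isOpen_Θ hx.2.2) m)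

theorem pd_inr_christoffel_inr_inr_inr (m : Fin N) (e c d : Fin N) :
    pd (Sum.inr m) (fun y => christoffel S.metric y (Sum.inr e) (Sum.inr c) (Sum.inr d)) x =
      pd m (fun θ => christoffel S.sphereMatrix θ e c d) (ac x) :=
  (pd_congr_domain hx _ fun _ hy => christoffel_inr_inr_inr hy e c d).trans
    (pd_comp_ac_inr (C := fun θ => christoffel S.sphereMatrix θ e c d)
      (differentiableAt_of_contDiffOn (contDiffOn_sphereChristoffel e c d) S.isOpen_Θ hx.2.2) m)

end

variable (S) in
/-- The `(t, r)` block of the Ricci tensor. -/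
noncomputable def ricBlock (p q : Fin 2) (z : ℝ × ℝ) : ℝ :=
  ∑ s, D s (S.Gam s p q) z - (∑ s, D p (S.Gam s s q) z + N * D p (S.L q) z)
    + (∑ m, ∑ k, S.Gam k p q z * S.Gam m k m z + N * ∑ k, S.Gam k p q z * S.L k z)
    - (∑ m, ∑ k, S.Gam k p m z * S.Gam m k q z + N * (S.L p z * S.L q z))

variable (S) in
/-- The factor of the metric of the sphere in the angular block of the Ricci tensor. -/
noncomputable def ricAng (z : ℝ × ℝ) : ℝ :=
  ∑ p, D p (S.K p) z + ∑ p, S.K p z * (∑ m, S.Gam m p m z + N * S.L p z)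
    - 2 * ∑ p, S.K p z * S.L p z + (N - 1)

section

variable (hx : x ∈ S.domain)

include hx

theorem ric_inl_inl (p q : Fin 2) :
    S.ric x (Sum.inl p) (Sum.inl q) = S.ricBlock p q (tr x) := by
  unfold ric ricci
  simp only [Fintype.sum_sum_type, pd_christoffel_inl_inl_inl hx, pd_christoffel_inr_inl_inl hx,
    pd_christoffel_inr_inr_inl hx, christoffel_inl_inl_inl hx, christoffel_inr_inl_inl hx,
    christoffel_inl_inl_inr hx, christoffel_inr_inr_inl hx, christoffel_inr_inl_inr hx]
  simp only [if_true, zero_mul, mul_zero, Finset.sum_const_zero, add_zero, zero_add,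
    Finset.sum_const, Finset.card_univ, Fintype.card_fin, nsmul_eq_mul, ite_mul, mul_ite,
    Finset.sum_ite_eq, Finset.mem_univ]
  rw [ricBlock]

/-- The only surviving contributions are two copies of `L_p` times the contracted Christoffel symbol
of the sphere, with opposite signs. -/
theorem ric_inl_inr (p : Fin 2) (c : Fin N) : S.ric x (Sum.inl p) (Sum.inr c) = 0 := by
  unfold ric ricci
  simp only [Fintype.sum_sum_type, pd_christoffel_inl_inl_inr hx, pd_inr_christoffel_inr_inl_inr hx,
    pd_christoffel_inr_inr_inr hx, christoffel_inl_inl_inr hx, christoffel_inr_inl_inl hx,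
    christoffel_inl_inr_inl hx, christoffel_inr_inl_inr hx, christoffel_inr_inr_inr hx]
  simp [sphereChristoffel_comm (S := S) (θ := ac x) _ c]

theorem ric_inr_inl (p : Fin 2) (c : Fin N) : S.ric x (Sum.inr c) (Sum.inl p) = 0 := by
  unfold ric ricci
  simp only [Fintype.sum_sum_type, pd_christoffel_inl_inr_inl hx, pd_inr_christoffel_inr_inr_inl hx,
    pd_inr_christoffel_inl_inl_inl hx, christoffel_inr_inl_inl hx,
    christoffel_inl_inr_inl hx, christoffel_inr_inr_inl hx, christoffel_inr_inl_inr hx,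
    christoffel_inr_inr_inr hx]
  simp [sphereChristoffel_comm (S := S) (θ := ac x) _ c]
  exact sub_eq_zero.2 (Finset.sum_congr rfl fun _ _ => mul_comm _ _)

theorem ric_inr_inr (c d : Fin N) :
    S.ric x (Sum.inr c) (Sum.inr d) = S.ricAng (tr x) * S.sphereMetric (ac x) c d := by
  -- The purely angular terms of the sum form the intrinsic Ricci tensor of the sphere; all others
  -- carry `K` or `L` and are already proportional to `s`.
  have hs := ricci_sphere hx.2.2 c d
  unfold ricci at hs
  unfold ric ricci
  simp only [Fintype.sum_sum_type, pd_christoffel_inl_inr_inr hx, pd_inr_christoffel_inr_inr_inr hx,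
    pd_christoffel_inl_inl_inr hx, christoffel_inl_inl_inr hx, christoffel_inl_inl_inl hx,
    christoffel_inl_inr_inl hx, christoffel_inr_inr_inl hx, christoffel_inr_inl_inr hx,
    christoffel_inr_inr_inr hx, christoffel_inl_inr_inr hx]
  simp [Finset.sum_add_distrib] at hs ⊢
  rw [ricAng]
  simp [Fin.sum_univ_two]
  linarith

end

/-- The quadratic terms are symmetric. In the off-diagonal components every derivative term is a
`t`-derivative of a function of `r` or an `r`-derivative of a function of `t`, hence zero. -/
theorem ricBlock_comm {z : ℝ × ℝ} (hz : z ∈ S.I ×ˢ S.J) (p q : Fin 2) :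
    S.ricBlock p q z = S.ricBlock q p z := by
  have hda := differentiableAt_of_contDiffOn (contDiffOn_deriv S.isOpen_I S.smooth_a)
    S.isOpen_I hz.1
  have ha := differentiableAt_of_contDiffOn S.smooth_a S.isOpen_I hz.1
  have hdb := differentiableAt_of_contDiffOn (contDiffOn_deriv S.isOpen_J S.smooth_b)
    S.isOpen_J hz.2
  have hb := differentiableAt_of_contDiffOn S.smooth_b S.isOpen_J hz.2
  have hdf₁ := differentiableAt_of_contDiffOn (contDiffOn_deriv S.isOpen_J S.smooth_f₁)
    S.isOpen_J hz.2
  have hf₁ := differentiableAt_of_contDiffOn S.smooth_f₁ S.isOpen_J hz.2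
  have hdf₂ := differentiableAt_of_contDiffOn (contDiffOn_deriv S.isOpen_J S.smooth_f₂)
    S.isOpen_J hz.2
  have hf₂ := differentiableAt_of_contDiffOn S.smooth_f₂ S.isOpen_J hz.2
  have e1 : D 0 (S.Gam 0 0 1) z = 0 := D_zero_comp_snd (hdb.div hb (b_ne_zero hz))
  have e2 : D 0 (S.Gam 1 1 1) z = 0 := D_zero_comp_snd (hdf₁.div hf₁ (f₁_ne_zero hz))
  have e3 : D 0 (S.L 1) z = 0 := D_zero_comp_snd (hdf₂.div hf₂ (f₂_ne_zero hz))
  have e4 : D 1 (S.Gam 0 0 0) z = 0 := D_one_comp_fst (differentiableAt_const 0)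
  have e5 : D 1 (S.Gam 1 0 1) z = 0 := D_one_comp_fst (hda.div ha (a_ne_zero hz))
  have e6 : D 1 (S.L 0) z = 0 := D_one_comp_fst (hda.div ha (a_ne_zero hz))
  have key : S.ricBlock 0 1 z = S.ricBlock 1 0 z := by
    simp only [ricBlock, Fin.sum_univ_two, e1, e2, e3, e4, e5, e6, S.Gam_comm _ 1 0]
    ring
  fin_cases p <;> fin_cases q
  · rfl
  · exact key
  · exact key.symm
  · rfl

variable (S) in
theorem contDiffOn_ricBlock (p q : Fin 2) : ContDiffOn ℝ ∞ (S.ricBlock p q) (S.I ×ˢ S.J) := by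
  have hG := S.contDiffOn_Gam
  have hL := S.contDiffOn_L
  have hDG : ∀ m p q s, ContDiffOn ℝ ∞ (D m (S.Gam p q s)) (S.I ×ˢ S.J) :=
    fun m p q s => S.contDiffOn_D m (hG p q s)
  have hDL : ∀ m p, ContDiffOn ℝ ∞ (D m (S.L p)) (S.I ×ˢ S.J) :=
    fun m p => S.contDiffOn_D m (hL p)
  unfold ricBlock
  fun_prop

variable (S) in
theorem contDiffOn_ricAng : ContDiffOn ℝ ∞ S.ricAng (S.I ×ˢ S.J) := by
  have hG := S.contDiffOn_Gam
  have hL := S.contDiffOn_L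
  have hK := S.contDiffOn_K
  have hDK : ∀ m p, ContDiffOn ℝ ∞ (D m (S.K p)) (S.I ×ˢ S.J) :=
    fun m p => S.contDiffOn_D m (hK p)
  unfold ricAng
  fun_prop

end SphericalDW

namespace SphericalDW

variable {N : ℕ} (S : SphericalDW N)

/-! ### Tensors with the symmetry of the spacetime -/

/-- A scalar field that is a smooth function of `(t, r)` on the domain. -/
def IsRadialScalar (X : (DWIdx N → ℝ) → ℝ) : Prop :=
  ∃ ρ : ℝ × ℝ → ℝ, ContDiffOn ℝ ∞ ρ (S.I ×ˢ S.J) ∧ ∀ x ∈ S.domain, X x = ρ (tr x)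

/-- A symmetric tensor field whose `(t, r)` block consists of smooth functions of `(t, r)`, whose
mixed block vanishes, and whose angular block is a smooth function of `(t, r)` times the metric of
the unit sphere. -/
def IsBlockTensor (T : (DWIdx N → ℝ) → DWIdx N → DWIdx N → ℝ) : Prop :=
  ∃ (τ : Fin 2 → Fin 2 → ℝ × ℝ → ℝ) (ζ : ℝ × ℝ → ℝ),
    (∀ p q, ContDiffOn ℝ ∞ (τ p q) (S.I ×ˢ S.J)) ∧ ContDiffOn ℝ ∞ ζ (S.I ×ˢ S.J) ∧
    ∀ x ∈ S.domain, τ 0 1 (tr x) = τ 1 0 (tr x) ∧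
      (∀ p q, T x (Sum.inl p) (Sum.inl q) = τ p q (tr x)) ∧
      (∀ p c, T x (Sum.inl p) (Sum.inr c) = 0) ∧ (∀ p c, T x (Sum.inr c) (Sum.inl p) = 0) ∧
      ∀ c d, T x (Sum.inr c) (Sum.inr d) = ζ (tr x) * S.sphereMetric (ac x) c d

variable {S}

section Algebra

variable {X Y : (DWIdx N → ℝ) → ℝ} {T U : (DWIdx N → ℝ) → DWIdx N → DWIdx N → ℝ}

theorem IsRadialScalar.add (hX : S.IsRadialScalar X) (hY : S.IsRadialScalar Y) :
    S.IsRadialScalar fun x => X x + Y x := by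
  obtain ⟨ρ, hρ, h⟩ := hX
  obtain ⟨ξ, hξ, h'⟩ := hY
  exact ⟨fun z => ρ z + ξ z, hρ.add hξ, fun x hx => by simp only [h x hx, h' x hx]⟩

theorem IsRadialScalar.mul (hX : S.IsRadialScalar X) (hY : S.IsRadialScalar Y) :
    S.IsRadialScalar fun x => X x * Y x := by
  obtain ⟨ρ, hρ, h⟩ := hX
  obtain ⟨ξ, hξ, h'⟩ := hY
  exact ⟨fun z => ρ z * ξ z, hρ.mul hξ, fun x hx => by simp only [h x hx, h' x hx]⟩

theorem isRadialScalar_const (c : ℝ) : S.IsRadialScalar fun _ => c :=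
  ⟨fun _ => c, contDiffOn_const, fun _ _ => rfl⟩

theorem IsBlockTensor.add (hT : S.IsBlockTensor T) (hU : S.IsBlockTensor U) :
    S.IsBlockTensor fun x i j => T x i j + U x i j := by
  obtain ⟨τ, ζ, hτ, hζ, h⟩ := hT
  obtain ⟨υ, ψ, hυ, hψ, h'⟩ := hU
  refine ⟨fun p q z => τ p q z + υ p q z, fun z => ζ z + ψ z, fun p q => (hτ p q).add (hυ p q),
    hζ.add hψ, fun x hx => ?_⟩
  obtain ⟨h1, h2, h3, h4, h5⟩ := h x hx
  obtain ⟨h1', h2', h3', h4', h5'⟩ := h' x hx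
  simp [h1, h2, h3, h4, h5, h1', h2', h3', h4', h5', add_mul]

theorem IsBlockTensor.smul (hX : S.IsRadialScalar X) (hT : S.IsBlockTensor T) :
    S.IsBlockTensor fun x i j => X x * T x i j := by
  obtain ⟨τ, ζ, hτ, hζ, h⟩ := hT
  obtain ⟨ρ, hρ, h'⟩ := hX
  refine ⟨fun p q z => ρ z * τ p q z, fun z => ρ z * ζ z, fun p q => hρ.mul (hτ p q),
    hρ.mul hζ, fun x hx => ?_⟩
  obtain ⟨h1, h2, h3, h4, h5⟩ := h x hx
  simp [h1, h2, h3, h4, h5, h' x hx, mul_assoc]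

theorem IsBlockTensor.congr (hT : S.IsBlockTensor T) (h : ∀ x ∈ S.domain, ∀ i j, U x i j = T x i j) :
    S.IsBlockTensor U := by
  obtain ⟨τ, ζ, hτ, hζ, h'⟩ := hT
  refine ⟨τ, ζ, hτ, hζ, fun x hx => ?_⟩
  simpa only [h x hx] using h' x hx

theorem IsBlockTensor.sub (hT : S.IsBlockTensor T) (hU : S.IsBlockTensor U) :
    S.IsBlockTensor fun x i j => T x i j - U x i j :=
  (hT.add (IsBlockTensor.smul (isRadialScalar_const (-1)) hU)).congr fun x _ i j => by ring

theorem isBlockTensor_metric : S.IsBlockTensor fun x i j => S.metric x i j := by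
  refine ⟨![![fun z => -(S.b z.2) ^ 2, fun _ => 0],
    ![fun _ => 0, fun z => S.a z.1 ^ 2 * S.f₁ z.2 ^ 2]], fun z => S.a z.1 ^ 2 * S.f₂ z.2 ^ 2,
    fun p q => ?_, (S.contDiffOn_a.pow 2).mul (S.contDiffOn_f₂.pow 2), fun x hx => ?_⟩
  · fin_cases p <;> fin_cases q
    · exact (S.contDiffOn_b.pow 2).neg
    · exact contDiffOn_const
    · exact contDiffOn_const
    · exact (S.contDiffOn_a.pow 2).mul (S.contDiffOn_f₁.pow 2)
  · refine ⟨rfl, fun p q => ?_, by simp, by simp, fun c d => by simp [tr]⟩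
    fin_cases p <;> fin_cases q <;> simp [tr]

theorem isBlockTensor_ric : S.IsBlockTensor S.ric :=
  ⟨S.ricBlock, S.ricAng, S.contDiffOn_ricBlock, S.contDiffOn_ricAng, fun _ hx =>
    ⟨ricBlock_comm (tr_mem hx) 0 1, ric_inl_inl hx, ric_inl_inr hx,
      fun p c => ric_inr_inl hx p c, ric_inr_inr hx⟩⟩

/-- The trace of a block tensor. -/
theorem trace_eq {x : DWIdx N → ℝ} (hx : x ∈ S.domain) {w : ℝ}
    (h : ∀ c d, T x (Sum.inr c) (Sum.inr d) = w * S.sphereMetric (ac x) c d) :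
    trace S.metric T x = -(S.b (rc x) ^ 2)⁻¹ * T x (Sum.inl 0) (Sum.inl 0)
      + (S.a (tc x) ^ 2 * S.f₁ (rc x) ^ 2)⁻¹ * T x (Sum.inl 1) (Sum.inl 1)
      + N * ((S.a (tc x) ^ 2 * S.f₂ (rc x) ^ 2)⁻¹ * w) := by
  unfold trace
  have hs : ∑ c, ∑ d, (S.metric x)⁻¹ (Sum.inr c) (Sum.inr d) * T x (Sum.inr c) (Sum.inr d) =
      N * ((S.a (tc x) ^ 2 * S.f₂ (rc x) ^ 2)⁻¹ * w) := by
    have : ∀ c, ∑ d, (S.metric x)⁻¹ (Sum.inr c) (Sum.inr d) * T x (Sum.inr c) (Sum.inr d) =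
        (S.a (tc x) ^ 2 * S.f₂ (rc x) ^ 2)⁻¹ * w := by
      intro c
      have h1 := sum_sphereMatrix_inv_mul hx c c
      rw [if_pos rfl] at h1
      rw [← mul_one (_ * w), ← h1, Finset.mul_sum]
      refine Finset.sum_congr rfl fun d _ => ?_
      rw [metric_inv_inr_inr hx, h, S.sphereMetric_comm (ac x) c d]
      ring
    simp only [this, Finset.sum_const, Finset.card_univ, Fintype.card_fin, nsmul_eq_mul]
  simp only [Fintype.sum_sum_type, metric_inv_inl_inr hx, metric_inv_inr_inl hx, zero_mul,
    Finset.sum_const_zero, add_zero, zero_add, Fin.sum_univ_two, metric_inv_tt hx,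
    metric_inv_tr hx, metric_inv_rt hx, metric_inv_rr hx, hs]

theorem IsBlockTensor.trace (hT : S.IsBlockTensor T) :
    S.IsRadialScalar (trace S.metric T) := by
  obtain ⟨τ, ζ, hτ, hζ, h⟩ := hT
  refine ⟨fun z => -(S.b z.2 ^ 2)⁻¹ * τ 0 0 z + (S.a z.1 ^ 2 * S.f₁ z.2 ^ 2)⁻¹ * τ 1 1 z
    + N * ((S.a z.1 ^ 2 * S.f₂ z.2 ^ 2)⁻¹ * ζ z), ?_, fun x hx => ?_⟩
  · have ha := S.contDiffOn_a.pow 2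
    refine ((((S.contDiffOn_b.pow 2).inv ?_).neg.mul (hτ 0 0)).add
      (((ha.mul (S.contDiffOn_f₁.pow 2)).inv ?_).mul (hτ 1 1))).add
      (contDiffOn_const.mul (((ha.mul (S.contDiffOn_f₂.pow 2)).inv ?_).mul hζ))
    · exact fun z hz => pow_ne_zero 2 (b_ne_zero hz)
    · exact fun z hz => mul_ne_zero (pow_ne_zero 2 (a_ne_zero hz)) (pow_ne_zero 2 (f₁_ne_zero hz))
    · exact fun z hz => mul_ne_zero (pow_ne_zero 2 (a_ne_zero hz)) (pow_ne_zero 2 (f₂_ne_zero hz))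
  · obtain ⟨-, h2, -, -, h5⟩ := h x hx
    rw [trace_eq hx h5, h2, h2]
    rfl

theorem isRadialScalar_R : S.IsRadialScalar S.R := isBlockTensor_ric.trace

theorem grad_inl {x : DWIdx N → ℝ} (hx : x ∈ S.domain) {ρ : ℝ × ℝ → ℝ}
    (hρ : ContDiffOn ℝ ∞ ρ (S.I ×ˢ S.J)) (h : ∀ x ∈ S.domain, X x = ρ (tr x)) (p : Fin 2) :
    grad X x (Sum.inl p) = D p ρ (tr x) :=
  (pd_congr_domain hx _ h).trans (pd_comp_tr_inl (differentiableAt_tr hx hρ) p)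

theorem grad_inr {x : DWIdx N → ℝ} (hx : x ∈ S.domain) {ρ : ℝ × ℝ → ℝ}
    (hρ : ContDiffOn ℝ ∞ ρ (S.I ×ˢ S.J)) (h : ∀ x ∈ S.domain, X x = ρ (tr x)) (c : Fin N) :
    grad X x (Sum.inr c) = 0 :=
  (pd_congr_domain hx _ h).trans (pd_comp_tr_inr (differentiableAt_tr hx hρ) c)

theorem IsRadialScalar.grad_mul_grad (hX : S.IsRadialScalar X) :
    S.IsBlockTensor fun x i j => grad X x i * grad X x j := by
  obtain ⟨ρ, hρ, h⟩ := hX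
  refine ⟨fun p q z => D p ρ z * D q ρ z, fun _ => 0,
    fun p q => (S.contDiffOn_D p hρ).mul (S.contDiffOn_D q hρ), contDiffOn_const, fun x hx => ?_⟩
  simp [grad_inl hx hρ h, grad_inr hx hρ h, mul_comm]

/-- There are no angular derivatives, so the angular block reduces to `-Γ^k_{cd} ∂_k ρ`, which is
proportional to `s` because `Γ^k_{cd} = K_k s_{cd}`. -/
theorem IsRadialScalar.hess (hX : S.IsRadialScalar X) : S.IsBlockTensor (S.hess X) := by
  obtain ⟨ρ, hρ, h⟩ := hX
  have hD := fun p => S.contDiffOn_D p hρ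
  refine ⟨fun p q z => D p (D q ρ) z - ∑ k, S.Gam k p q z * D k ρ z,
    fun z => -∑ k, S.K k z * D k ρ z,
    fun p q => (S.contDiffOn_D p (hD q)).sub
      (ContDiffOn.sum fun k _ => (S.contDiffOn_Gam k p q).mul (hD k)),
    (ContDiffOn.sum fun k _ => (S.contDiffOn_K k).mul (hD k)).neg, fun x hx => ?_⟩
  have e1 : ∀ i q, pd i (fun y => grad X y (Sum.inl q)) x = pd i (fun y => D q ρ (tr y)) x :=
    fun i q => pd_congr_domain hx i fun y hy => grad_inl hy hρ h q
  have e2 : ∀ i c, pd i (fun y => grad X y (Sum.inr c)) x = 0 :=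
    fun i c => (pd_congr_domain hx i fun y hy => grad_inr hy hρ h c).trans (pd_const _ _)
  have e3 := fun p q => pd_comp_tr_inl (differentiableAt_tr hx (hD q)) p
  have e4 : ∀ (c : Fin N) q, _ = _ := fun c q => pd_comp_tr_inr (differentiableAt_tr hx (hD q)) c
  have hcomm : D 0 (D 1 ρ) (tr x) = D 1 (D 0 ρ) (tr x) :=
    fderiv_fderiv_comm ((hρ.contDiffAt (S.isOpen_tr.mem_nhds (tr_mem hx))).of_le
      (by norm_cast)) _ _
  refine ⟨?_, fun p q => ?_, fun p c => ?_, fun p c => ?_, fun c d => ?_⟩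
  · simp only [hcomm, S.Gam_comm _ 1 0]
  all_goals
    unfold SphericalDW.hess hessian covD
    simp [e1, e2, e3, e4, grad_inl hx hρ h, grad_inr hx hρ h, christoffel_inl_inl_inl hx,
      christoffel_inl_inl_inr hx, christoffel_inl_inr_inl hx, christoffel_inl_inr_inr hx]
  ring

end Algebra

/-! ### The velocity and the acceleration -/

section Velocity

variable {x : DWIdx N → ℝ}

@[simp] theorem u_t : S.u x (Sum.inl 0) = -S.b (rc x) := by simp [u]

@[simp] theorem u_r : S.u x (Sum.inl 1) = 0 := by simp [u]

@[simp] theorem u_inr (c : Fin N) : S.u x (Sum.inr c) = 0 := by simp [u]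

@[simp] theorem radial_t : S.radial x (Sum.inl 0) = 0 := by simp [radial]

@[simp] theorem radial_r : S.radial x (Sum.inl 1) = S.a (tc x) * S.f₁ (rc x) := by simp [radial]

@[simp] theorem radial_inr (c : Fin N) : S.radial x (Sum.inr c) = 0 := by simp [radial]

theorem dotProd_inl {α β : (DWIdx N → ℝ) → DWIdx N → ℝ} (hx : x ∈ S.domain)
    (hα : ∀ c, α x (Sum.inr c) = 0) :
    dotProd S.metric α β x =
      -(S.b (rc x) ^ 2)⁻¹ * α x (Sum.inl 0) * β x (Sum.inl 0)
      + (S.a (tc x) ^ 2 * S.f₁ (rc x) ^ 2)⁻¹ * α x (Sum.inl 1) * β x (Sum.inl 1) := by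
  unfold dotProd
  simp [metric_inv_inl_inr hx, metric_inv_inr_inl hx, metric_inv_tt hx,
    metric_inv_tr hx, metric_inv_rt hx, metric_inv_rr hx, hα]

theorem pd_b (hx : x ∈ S.domain) (i : DWIdx N) : pd i (fun y => -S.b (rc y)) x =
    Sum.elim ![0, -deriv S.b (rc x)] (fun _ => 0) i := by
  have h := pd_comp_mul (A := fun _ => -1) (differentiableAt_const _) (differentiableAt_b hx) i
  simpa using h

theorem acc_eq (hx : x ∈ S.domain) (j : DWIdx N) :
    S.acc x j = if j = Sum.inl 1 then deriv S.b (rc x) / S.b (rc x) else 0 := by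
  have hb := (S.b_pos _ hx.2.1).ne'
  unfold acc covD
  obtain p | c := j
  · fin_cases p
    · simp [metric_inv_tt hx, metric_inv_inr_inl hx, metric_inv_rt hx, pd_b hx,
        christoffel_inl_inl_inl hx, Gam]
    · simp [metric_inv_tt hx, metric_inv_inr_inl hx, metric_inv_rt hx,
        christoffel_inl_inl_inl hx, Gam, tr]
      field_simp
  · simp [metric_inv_inr_inl hx, christoffel_inl_inl_inr hx]

theorem acc_t (hx : x ∈ S.domain) : S.acc x (Sum.inl 0) = 0 := by simp [acc_eq hx]

theorem acc_r (hx : x ∈ S.domain) : S.acc x (Sum.inl 1) = deriv S.b (rc x) / S.b (rc x) := by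
  simp [acc_eq hx]

theorem acc_inr (hx : x ∈ S.domain) (c : Fin N) : S.acc x (Sum.inr c) = 0 := by simp [acc_eq hx]

theorem deriv_b_ne_zero (hx : x ∈ S.domain) (h : S.acc x ≠ 0) : deriv S.b (rc x) ≠ 0 := by
  intro h0
  apply h
  ext j
  simp [acc_eq hx, h0]

variable {T : (DWIdx N → ℝ) → DWIdx N → DWIdx N → ℝ}

theorem IsBlockTensor.isPerfectTensor (hacc : ∀ x ∈ S.domain, S.acc x ≠ 0)
    (hT : S.IsBlockTensor T) : S.IsPerfectTensor T := by
  obtain ⟨τ, ζ, -, -, h⟩ := hT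
  -- The coefficient of `g` is dictated by the angular block, where `u` and `u̇` vanish. The
  -- coefficients of `u u` and `u̇ u̇` then correct the two diagonal entries, and the mixed one is
  -- fixed by `u_t u̇_r = -b'`.
  refine ⟨fun x => (τ 0 0 (tr x) + S.b (rc x) ^ 2 *
      (ζ (tr x) / (S.a (tc x) ^ 2 * S.f₂ (rc x) ^ 2))) / S.b (rc x) ^ 2,
    fun x => ζ (tr x) / (S.a (tc x) ^ 2 * S.f₂ (rc x) ^ 2),
    fun x => -(τ 0 1 (tr x) / deriv S.b (rc x)),
    fun x => (τ 1 1 (tr x) - S.a (tc x) ^ 2 * S.f₁ (rc x) ^ 2 *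
      (ζ (tr x) / (S.a (tc x) ^ 2 * S.f₂ (rc x) ^ 2))) * (S.b (rc x) / deriv S.b (rc x)) ^ 2,
    fun x hx i j => ?_⟩
  have ha := (S.a_pos _ hx.1).ne'
  have hb := (S.b_pos _ hx.2.1).ne'
  have h2 := (S.f₂_pos _ hx.2.1).ne'
  have hdb := deriv_b_ne_zero hx (hacc x hx)
  obtain ⟨h01, htr, hlr, hrl, hrr⟩ := h x hx
  obtain p | c := i <;> obtain q | d := j
  · fin_cases p <;> fin_cases q <;> simp [htr, acc_t hx, acc_r hx]
    · field_simp
      ring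
    · field_simp
    · rw [← h01]
      field_simp
    · field_simp
      ring
  · simp [hlr, acc_inr hx]
  · simp [hrl, acc_inr hx]
  · simp [hrr, acc_inr hx]
    field_simp

theorem IsBlockTensor.isAnisotropicFluid (hacc : ∀ x ∈ S.domain, S.acc x ≠ 0)
    (hT : S.IsBlockTensor T) : S.IsAnisotropicFluid T := by
  -- If `Θ` is empty the acceleration hypothesis says nothing about `b'` on `J`, and the quotient
  -- used below for `c` might not be smooth; constants suffice then.
  obtain hne | hne := S.domain.eq_empty_or_nonempty
  · exact ⟨fun _ => 0, fun _ => 0, fun _ => 0, fun _ => 0, contDiffOn_const, contDiffOn_const,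
      contDiffOn_const, contDiffOn_const, fun x hx => by simp [hne] at hx⟩
  obtain ⟨τ, ζ, hτ, hζ, h⟩ := hT
  -- Smoothness is required on all of `I × J`: attaching the angles of one fixed point of the domain
  -- to `z` yields a point where the acceleration is nonzero.
  have hdb' : ∀ z ∈ S.I ×ˢ S.J, deriv S.b z.2 ≠ 0 := by
    intro z hz
    obtain ⟨x, hx⟩ := hne
    have hy : (Sum.elim ![z.1, z.2] (ac x) : DWIdx N → ℝ) ∈ S.domain := ⟨hz.1, hz.2, hx.2.2⟩
    exact deriv_b_ne_zero hy (hacc _ hy)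
  -- Energy density and pressures are the diagonal components in the orthonormal frame; `c` again
  -- comes from `u_t u̇_r = -b'`.
  refine ⟨fun z => τ 0 0 z / S.b z.2 ^ 2, fun z => τ 1 1 z / (S.a z.1 ^ 2 * S.f₁ z.2 ^ 2),
    fun z => ζ z / (S.a z.1 ^ 2 * S.f₂ z.2 ^ 2), fun z => -(τ 0 1 z / deriv S.b z.2),
    (hτ 0 0).div (S.contDiffOn_b.pow 2) fun z hz => pow_ne_zero 2 (b_ne_zero hz),
    (hτ 1 1).div ((S.contDiffOn_a.pow 2).mul (S.contDiffOn_f₁.pow 2)) fun z hz =>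
      mul_ne_zero (pow_ne_zero 2 (a_ne_zero hz)) (pow_ne_zero 2 (f₁_ne_zero hz)),
    hζ.div ((S.contDiffOn_a.pow 2).mul (S.contDiffOn_f₂.pow 2)) fun z hz =>
      mul_ne_zero (pow_ne_zero 2 (a_ne_zero hz)) (pow_ne_zero 2 (f₂_ne_zero hz)),
    ((hτ 0 1).div S.contDiffOn_deriv_b hdb').neg, fun x hx i j => ?_⟩
  have ha := (S.a_pos _ hx.1).ne'
  have hb := (S.b_pos _ hx.2.1).ne'
  have h1 := (S.f₁_pos _ hx.2.1).ne'
  have h2 := (S.f₂_pos _ hx.2.1).ne'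
  have hdb := deriv_b_ne_zero hx (hacc x hx)
  have hN : (N : ℝ) + 1 ≠ 0 := by positivity
  obtain ⟨h01, htr, hlr, hrl, hrr⟩ := h x hx
  simp only [tr] at h01 htr hrr
  obtain p | c := i <;> obtain q | d := j
  · fin_cases p <;> fin_cases q <;> simp [htr, SphericalDW.h, acc_t hx, acc_r hx]
    · field_simp
      ring
    · field_simp
    · rw [← h01]
      field_simp
    · field_simp
      ring
  · simp [hlr, SphericalDW.h, acc_inr hx]
  · simp [hrl, SphericalDW.h, acc_inr hx]
  · simp [hrr, SphericalDW.h, acc_inr hx]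
    field_simp
    ring

end Velocity

end SphericalDW

namespace SphericalDW

variable {N : ℕ} {S : SphericalDW N} {x : DWIdx N → ℝ}

/-! ### Kinematic scalars and derivatives along the velocity and the acceleration -/

theorem dot_eq (hx : x ∈ S.domain) (X : (DWIdx N → ℝ) → ℝ) :
    S.dot X x = (S.b (rc x))⁻¹ * pd (Sum.inl 0) X x := by
  have hb := (S.b_pos _ hx.2.1).ne'
  rw [dot, dotProd_inl hx u_inr]
  simp only [u_t, u_r, grad, mul_zero, zero_mul, add_zero]
  field_simp

theorem accDeriv_eq (hx : x ∈ S.domain) (X : (DWIdx N → ℝ) → ℝ) :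
    S.accDeriv X x = (S.a (tc x) ^ 2 * S.f₁ (rc x) ^ 2)⁻¹ * (deriv S.b (rc x) / S.b (rc x))
      * pd (Sum.inl 1) X x := by
  rw [accDeriv, dotProd_inl hx (acc_inr hx), acc_t hx, acc_r hx]
  simp [grad]

theorem η_eq (hx : x ∈ S.domain) :
    S.η x = (S.a (tc x) ^ 2)⁻¹ *
      ((deriv S.b (rc x) / S.b (rc x)) ^ 2 / S.f₁ (rc x) ^ 2) := by
  rw [η, dotProd_inl hx (acc_inr hx), acc_t hx, acc_r hx]
  ring

/-- The factor `a² f₁²` cancels against `η`, so the coefficient depends on `r` alone and `tilde` is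
easy to iterate. -/
theorem tilde_eq (hx : x ∈ S.domain) (hb' : deriv S.b (rc x) ≠ 0) (X : (DWIdx N → ℝ) → ℝ) :
    S.tilde X x = S.b (rc x) / deriv S.b (rc x) * pd (Sum.inl 1) X x := by
  have ha := (S.a_pos _ hx.1).ne'
  have hb := (S.b_pos _ hx.2.1).ne'
  have h1 := (S.f₁_pos _ hx.2.1).ne'
  rw [tilde, accDeriv_eq hx, η_eq hx]
  field_simp

/-- All `N + 1` spatial directions expand at the same rate `a' / (a b)`, so the division by `N + 1`
leaves that rate. -/
theorem φ_eq (hx : x ∈ S.domain) : S.φ x = deriv S.a (tc x) / (S.a (tc x) * S.b (rc x)) := by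
  have ha := (S.a_pos _ hx.1).ne'
  have hb := (S.b_pos _ hx.2.1).ne'
  have h1 := (S.f₁_pos _ hx.2.1).ne'
  have h2 := (S.f₂_pos _ hx.2.1).ne'
  have hN : (N : ℝ) + 1 ≠ 0 := by positivity
  rw [φ, trace_eq hx (w := S.K 0 (tr x) * S.b (rc x))]
  · simp [covD, pd_b hx, christoffel_inl_inl_inl hx, Gam, K, tr]
    field_simp
    ring
  · intro c d
    simp [covD, christoffel_inl_inr_inr hx]
    ring

theorem differentiableAt_deriv_b (hx : x ∈ S.domain) :
    DifferentiableAt ℝ (deriv S.b) (rc x) :=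
  differentiableAt_of_contDiffOn (contDiffOn_deriv S.isOpen_J S.smooth_b) S.isOpen_J hx.2.1

theorem pd_comp_rc {B : ℝ → ℝ} {B' : ℝ} (hB : HasDerivAt B B' (rc x)) (i : DWIdx N) :
    pd i (fun y => B (rc y)) x = Sum.elim ![0, B'] (fun _ => 0) i := by
  simpa [hB.deriv] using
    pd_comp_mul (A := fun _ => 1) (differentiableAt_const _) hB.differentiableAt i

theorem pd_acc_r (hx : x ∈ S.domain) (i : DWIdx N) :
    pd i (fun y => S.acc y (Sum.inl 1)) x = Sum.elim ![0,
      (deriv (deriv S.b) (rc x) * S.b (rc x) - deriv S.b (rc x) * deriv S.b (rc x))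
        / S.b (rc x) ^ 2] (fun _ => 0) i :=
  (pd_congr_domain hx i fun _ hy => acc_r hy).trans (pd_comp_rc (B := fun r => deriv S.b r / S.b r)
    ((differentiableAt_deriv_b hx).hasDerivAt.fun_div (differentiableAt_b hx).hasDerivAt
      (S.b_pos _ hx.2.1).ne') i)

theorem pd_acc_t (hx : x ∈ S.domain) (i : DWIdx N) :
    pd i (fun y => S.acc y (Sum.inl 0)) x = 0 :=
  (pd_congr_domain hx i fun _ hy => acc_t hy).trans (pd_const _ _)

theorem pd_acc_inr (hx : x ∈ S.domain) (i : DWIdx N) (c : Fin N) :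
    pd i (fun y => S.acc y (Sum.inr c)) x = 0 :=
  (pd_congr_domain hx i fun _ hy => acc_inr hy c).trans (pd_const _ _)

theorem accDeriv_η (hx : x ∈ S.domain) (hb' : deriv S.b (rc x) ≠ 0) :
    S.accDeriv S.η x = 2 * S.η x * ((S.a (tc x) ^ 2 * S.f₁ (rc x) ^ 2)⁻¹ *
      (deriv (deriv S.b) (rc x) / S.b (rc x) - (deriv S.b (rc x) / S.b (rc x)) ^ 2
        - deriv S.b (rc x) * deriv S.f₁ (rc x) / (S.b (rc x) * S.f₁ (rc x)))) := by
  have ha := (S.a_pos _ hx.1).ne'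
  have hb := (S.b_pos _ hx.2.1).ne'
  have h1 := (S.f₁_pos _ hx.2.1).ne'
  have hB := (((differentiableAt_deriv_b hx).hasDerivAt.fun_div (differentiableAt_b hx).hasDerivAt
    hb).fun_pow 2).fun_div ((differentiableAt_f₁ hx).hasDerivAt.fun_pow 2) (pow_ne_zero 2 h1)
  have hA : DifferentiableAt ℝ (fun t => (S.a t ^ 2)⁻¹) (tc x) :=
    ((differentiableAt_a hx).fun_pow 2).fun_inv (pow_ne_zero 2 ha)
  have h := (pd_congr_domain hx (Sum.inl 1) fun _ hy => η_eq hy).trans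
    (pd_comp_mul hA hB.differentiableAt _)
  rw [accDeriv_eq hx, h, hB.deriv, η_eq hx]
  simp
  field_simp

theorem divAcc_eq (hx : x ∈ S.domain) :
    S.divAcc x = (S.a (tc x) ^ 2 * S.f₁ (rc x) ^ 2)⁻¹ *
      (N * (deriv S.f₂ (rc x) * deriv S.b (rc x) / (S.f₂ (rc x) * S.b (rc x)))
        + deriv (deriv S.b) (rc x) / S.b (rc x)
        - deriv S.b (rc x) * deriv S.f₁ (rc x) / (S.b (rc x) * S.f₁ (rc x))) := by
  have ha := (S.a_pos _ hx.1).ne'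
  have hb := (S.b_pos _ hx.2.1).ne'
  have h1 := (S.f₁_pos _ hx.2.1).ne'
  have h2 := (S.f₂_pos _ hx.2.1).ne'
  rw [divAcc, trace_eq hx (w := -(S.K 1 (tr x) * (deriv S.b (rc x) / S.b (rc x))))]
  · simp [covD, pd_acc_t hx, pd_acc_r hx, acc_t hx, acc_r hx, acc_inr hx,
      christoffel_inl_inl_inl hx, Gam, K, tr]
    field_simp
    ring
  · intro c d
    simp [covD, pd_acc_inr hx, acc_t hx, acc_r hx, acc_inr hx, christoffel_inl_inr_inr hx]
    ring

/-! ### Perfect 2-scalars -/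

section PerfectScalar

variable {X : (DWIdx N → ℝ) → ℝ}

/-- Neither `u` nor `u̇` has angular components. This is all that is used of the hypothesis on `X`
in its Hessian; `X` need not be a global function of `(t, r)`, since `Θ` may be disconnected. -/
theorem IsPerfectTwoScalar.grad_inr (hX : S.IsPerfectTwoScalar X) (hx : x ∈ S.domain)
    (c : Fin N) : grad X x (Sum.inr c) = 0 := by
  obtain ⟨Y, hY⟩ := hX
  simp [hY x hx, acc_inr hx]

theorem IsRadialScalar.isPerfectTwoScalar (hacc : ∀ x ∈ S.domain, S.acc x ≠ 0)
    (hX : S.IsRadialScalar X) : S.IsPerfectTwoScalar X := by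
  obtain ⟨ρ, hρ, h⟩ := hX
  refine ⟨S.tilde X, fun x hx j => ?_⟩
  have hb := (S.b_pos _ hx.2.1).ne'
  have hb' := deriv_b_ne_zero hx (hacc x hx)
  rw [dot_eq hx, tilde_eq hx hb']
  obtain p | c := j
  · fin_cases p
    · simp [grad, hb, acc_t hx]
    · simp [grad, acc_r hx]
      field_simp
  · simp [SphericalDW.grad_inr hx hρ h, acc_inr hx]

variable (hacc : ∀ x ∈ S.domain, S.acc x ≠ 0) (hC : ContDiffOn ℝ 2 X S.domain)
  (hX : S.IsPerfectTwoScalar X) (hx : x ∈ S.domain)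

include hC hx

theorem differentiableAt_pd (i : DWIdx N) : DifferentiableAt ℝ (pd i X) x :=
  ((pd_contDiffOn i S.isOpen_domain hC (m := 1) (by norm_num)).contDiffAt
    (S.isOpen_domain.mem_nhds hx)).differentiableAt (by norm_num)

theorem pd_comm_domain (i j : DWIdx N) : pd i (pd j X) x = pd j (pd i X) x :=
  pd_comm i j (hC.contDiffAt (S.isOpen_domain.mem_nhds hx))

theorem pd_comp_rc_mul {B : ℝ → ℝ} {B' : ℝ} (hB : HasDerivAt B B' (rc x)) (p : Fin 2)
    (i : DWIdx N) : pd (Sum.inl p) (fun y => B (rc y) * pd i X y) x =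
      ![0, B'] p * pd i X x + B (rc x) * pd (Sum.inl p) (pd i X) x := by
  have hd : DifferentiableAt ℝ (fun y => B (rc y)) x :=
    hB.differentiableAt.comp x hasFDerivAt_rc.differentiableAt
  rw [pd_mul _ hd (differentiableAt_pd hC hx i), pd_comp_rc hB]
  rfl

theorem pd_dot (p : Fin 2) : pd (Sum.inl p) (S.dot X) x =
    ![0, -deriv S.b (rc x) / S.b (rc x) ^ 2] p * pd (Sum.inl 0) X x
      + (S.b (rc x))⁻¹ * pd (Sum.inl p) (pd (Sum.inl 0) X) x :=
  (pd_congr_domain hx _ fun _ hy => dot_eq hy X).trans (pd_comp_rc_mul hC hx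
    ((differentiableAt_b hx).hasDerivAt.fun_inv (S.b_pos _ hx.2.1).ne') p _)

include hacc in
theorem pd_tilde (p : Fin 2) : pd (Sum.inl p) (S.tilde X) x =
    ![0, (deriv S.b (rc x) * deriv S.b (rc x) - S.b (rc x) * deriv (deriv S.b) (rc x))
        / deriv S.b (rc x) ^ 2] p * pd (Sum.inl 1) X x
      + S.b (rc x) / deriv S.b (rc x) * pd (Sum.inl p) (pd (Sum.inl 1) X) x :=
  (pd_congr_domain hx _ fun y hy => tilde_eq hy (deriv_b_ne_zero hy (hacc y hy)) X).trans
    (pd_comp_rc_mul hC hx (B := fun r => S.b r / deriv S.b r)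
      ((differentiableAt_b hx).hasDerivAt.fun_div (differentiableAt_deriv_b hx).hasDerivAt
        (deriv_b_ne_zero hx (hacc x hx))) p _)

omit hC in
include hX in
theorem IsPerfectTwoScalar.hess_inl_inl (p q : Fin 2) :
    S.hess X x (Sum.inl p) (Sum.inl q) = pd (Sum.inl p) (pd (Sum.inl q) X) x
      - (S.Gam 0 p q (tr x) * pd (Sum.inl 0) X x + S.Gam 1 p q (tr x) * pd (Sum.inl 1) X x) := by
  have h := hX.grad_inr hx
  unfold hess hessian covD
  simp [christoffel_inl_inl_inl hx, h]
  rfl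

omit hC in
include hX in
theorem IsPerfectTwoScalar.hess_inl_inr (p : Fin 2) (c : Fin N) :
    S.hess X x (Sum.inl p) (Sum.inr c) = 0 := by
  have h := hX.grad_inr hx
  have h2 : pd (Sum.inl p) (fun y => grad X y (Sum.inr c)) x = 0 :=
    (pd_congr_domain hx _ fun y hy => hX.grad_inr hy c).trans (pd_const _ _)
  unfold hess hessian covD
  simp [christoffel_inl_inl_inr hx, h, h2]

-- Here the outer derivative is the angular one, so `C²` regularity is used to interchange it with
-- `∂_p` and differentiate a vanishing function.
include hX in
theorem IsPerfectTwoScalar.hess_inr_inl (p : Fin 2) (c : Fin N) :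
    S.hess X x (Sum.inr c) (Sum.inl p) = 0 := by
  have h := hX.grad_inr hx
  have h2 : pd (Sum.inr c) (fun y => grad X y (Sum.inl p)) x = 0 :=
    (pd_comm_domain hC hx _ _).trans
      ((pd_congr_domain hx _ fun y hy => hX.grad_inr hy c).trans (pd_const _ _))
  unfold hess hessian covD
  simp [christoffel_inl_inr_inl hx, h, h2]

omit hC in
include hX in
theorem IsPerfectTwoScalar.hess_inr_inr (c d : Fin N) :
    S.hess X x (Sum.inr c) (Sum.inr d) =
      -(S.K 0 (tr x) * pd (Sum.inl 0) X x + S.K 1 (tr x) * pd (Sum.inl 1) X x)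
        * S.sphereMetric (ac x) c d := by
  have h := hX.grad_inr hx
  have h2 : pd (Sum.inr c) (fun y => grad X y (Sum.inr d)) x = 0 :=
    (pd_congr_domain hx _ fun y hy => hX.grad_inr hy d).trans (pd_const _ _)
  unfold hess hessian covD
  simp [christoffel_inl_inr_inr hx, h, h2]
  simp [grad]
  ring

include hacc hX in
/-- The Hessian of a perfect 2-scalar. -/
theorem IsPerfectTwoScalar.hess_eq (hN : 1 ≤ N) (i j : DWIdx N) :
    S.hess X x i j =
      -(S.dot X x * S.φ x) * S.metric x i j
      + S.u x i * S.u x j * (S.dot (S.dot X) x - S.φ x * S.dot X x - S.η x * S.tilde X x)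
      - (S.acc x i * S.u x j + S.u x i * S.acc x j)
          * (S.tilde (S.dot X) x - S.φ x * S.tilde X x)
      + S.acc x i * S.acc x j
          * (S.tilde (S.tilde X) x + S.tilde X x * (S.accDeriv S.η x / (2 * S.η x ^ 2)))
      + S.proj x i j * S.tilde X x
          * ((-S.η x + S.divAcc x - S.accDeriv S.η x / (2 * S.η x)) / (N : ℝ)) := by
  have ha := (S.a_pos _ hx.1).ne'
  have hb := (S.b_pos _ hx.2.1).ne'
  have h1 := (S.f₁_pos _ hx.2.1).ne'
  have h2 := (S.f₂_pos _ hx.2.1).ne'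
  have hb' := deriv_b_ne_zero hx (hacc x hx)
  have hN' : (N : ℝ) ≠ 0 := by positivity
  have hη : S.η x ≠ 0 := by rw [η_eq hx]; positivity
  have e1 : S.accDeriv S.η x / (2 * S.η x) = (S.a (tc x) ^ 2 * S.f₁ (rc x) ^ 2)⁻¹ *
      (deriv (deriv S.b) (rc x) / S.b (rc x) - (deriv S.b (rc x) / S.b (rc x)) ^ 2
        - deriv S.b (rc x) * deriv S.f₁ (rc x) / (S.b (rc x) * S.f₁ (rc x))) := by
    rw [accDeriv_η hx hb']; field_simp
  have e2 : S.accDeriv S.η x / (2 * S.η x ^ 2) = S.accDeriv S.η x / (2 * S.η x) / S.η x := by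
    field_simp
  -- The terms in `b''`, `f₁'` and `(b'/b)²` cancel. What remains is the `f₂'` term of the
  -- divergence, summed over `N` angular directions, and the division by `N` removes the factor.
  have e3 : (-S.η x + S.divAcc x - S.accDeriv S.η x / (2 * S.η x)) / (N : ℝ) =
      (S.a (tc x) ^ 2 * S.f₁ (rc x) ^ 2)⁻¹ *
        (deriv S.f₂ (rc x) * deriv S.b (rc x) / (S.f₂ (rc x) * S.b (rc x))) := by
    rw [e1, divAcc_eq hx, η_eq hx]
    field_simp
    ring
  -- The outer operators of the iterated derivatives are expanded first, while the inner ones are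
  -- still recognizable; `pd_dot` occurs twice, for the `t`- and the `r`-derivative of `Ẋ`.
  rw [e3, e2, e1, proj, dot_eq hx (S.dot X), tilde_eq hx hb' (S.dot X), tilde_eq hx hb' (S.tilde X),
    pd_dot hC hx, pd_dot hC hx, pd_tilde hacc hC hx, φ_eq hx, η_eq hx, dot_eq hx, tilde_eq hx hb']
  obtain p | c := i <;> obtain q | d := j
  · rw [hX.hess_inl_inl hx]
    fin_cases p <;> fin_cases q <;> simp [acc_t hx, acc_r hx, Gam, tr]
    · field_simp
      ring
    · rw [pd_comm_domain hC hx (Sum.inl 0) (Sum.inl 1)]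
      field_simp
      ring
    · field_simp
      ring
    · field_simp
      ring
  · rw [hX.hess_inl_inr hx]
    simp [acc_inr hx]
  · rw [hX.hess_inr_inl hC hx]
    simp [acc_inr hx]
  · rw [hX.hess_inr_inr hx]
    simp [acc_inr hx, K, tr]
    field_simp
    ring

omit hx in
include hacc hX in
theorem IsPerfectTwoScalar.isPerfectTensor_hess (hN : 1 ≤ N) : S.IsPerfectTensor (S.hess X) := by
  -- `W` is the coefficient of `N_{ij} = g_{ij} + u_i u_j - u̇_i u̇_j / η`, so it is shared among
  -- three of the four perfect coefficients.
  let W := fun x => S.tilde X x *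
    ((-S.η x + S.divAcc x - S.accDeriv S.η x / (2 * S.η x)) / (N : ℝ))
  refine ⟨fun x => S.dot (S.dot X) x - S.φ x * S.dot X x - S.η x * S.tilde X x + W x,
    fun x => -(S.dot X x * S.φ x) + W x,
    fun x => -(S.tilde (S.dot X) x - S.φ x * S.tilde X x),
    fun x => S.tilde (S.tilde X) x + S.tilde X x * (S.accDeriv S.η x / (2 * S.η x ^ 2))
      - W x / S.η x, fun x hx i j => ?_⟩
  rw [hX.hess_eq hacc hC hx hN, proj]
  ring

end PerfectScalar

/-! ### The field equations -/

theorem IsRadialScalar.comp {X : (DWIdx N → ℝ) → ℝ} (hX : S.IsRadialScalar X) {V : Set ℝ}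
    {F : ℝ → ℝ} (hF : ContDiffOn ℝ ∞ F V) (hV : ∀ x ∈ S.domain, X x ∈ V) :
    S.IsRadialScalar fun x => F (X x) := by
  -- With an empty domain nothing places the values of `ρ` in `V`. Otherwise each point of `I × J`
  -- is lifted to the domain with the angles of `x₀`.
  obtain hne | ⟨x₀, hx₀⟩ := S.domain.eq_empty_or_nonempty
  · exact ⟨fun _ => 0, contDiffOn_const, fun x hx => by simp [hne] at hx⟩
  obtain ⟨ρ, hρ, h⟩ := hX
  refine ⟨fun z => F (ρ z), hF.comp hρ fun z hz => ?_, fun x hx => by simp only [h x hx]⟩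
  have hy : (Sum.elim ![z.1, z.2] (ac x₀) : DWIdx N → ℝ) ∈ S.domain := ⟨hz.1, hz.2, hx₀.2.2⟩
  have := hV _ hy
  rwa [h _ hy] at this

theorem contDiffOn_iteratedDeriv {V : Set ℝ} {f : ℝ → ℝ} (hV : IsOpen V)
    (hf : ContDiffOn ℝ ∞ f V) (k : ℕ) : ContDiffOn ℝ ∞ (iteratedDeriv k f) V := by
  induction k with
  | zero => simpa using hf
  | succ k ih => rw [iteratedDeriv_succ]; exact contDiffOn_deriv hV ih

section FieldEquations

variable {V : Set ℝ} {f : ℝ → ℝ} (hV : IsOpen V) (hf : ContDiffOn ℝ ∞ f V)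
  (hR : ∀ x ∈ S.domain, S.R x ∈ V)

include hV hf hR

theorem isBlockTensor_ricTerm : S.IsBlockTensor (S.ricTerm f) :=
  IsBlockTensor.smul (isRadialScalar_R.comp (contDiffOn_deriv hV hf) hR) isBlockTensor_ric

theorem isBlockTensor_gradTerm : S.IsBlockTensor (S.gradTerm f) :=
  IsBlockTensor.smul (isRadialScalar_R.comp (contDiffOn_iteratedDeriv hV hf 3) hR)
    isRadialScalar_R.grad_mul_grad

theorem isBlockTensor_hessTerm : S.IsBlockTensor (S.hessTerm f) :=
  IsBlockTensor.smul (isRadialScalar_R.comp (contDiffOn_iteratedDeriv hV hf 2) hR)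
    isRadialScalar_R.hess

/-- The bracket is a radial scalar, since `(∇R)²` and `∇²R` are traces of the block tensors `∇R ∇R`
and `∇∇R`. -/
theorem isBlockTensor_metricTerm : S.IsBlockTensor (S.metricTerm f) := by
  have h3 := isRadialScalar_R.comp (contDiffOn_iteratedDeriv hV hf 3) hR
  have h2 := isRadialScalar_R.comp (contDiffOn_iteratedDeriv hV hf 2) hR
  have h0 := isRadialScalar_R.comp hf hR
  have hs := ((h3.mul isRadialScalar_R.grad_mul_grad.trace).add
    (h2.mul isRadialScalar_R.hess.trace)).add ((isRadialScalar_const (-(1 / 2))).mul h0)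
  refine (IsBlockTensor.smul hs isBlockTensor_metric).congr fun x _ i j => ?_
  simp only [metricTerm, dotProd, trace, mul_assoc]
  ring

theorem isBlockTensor_fieldLHS : S.IsBlockTensor (S.fieldLHS f) :=
  ((isBlockTensor_ricTerm hV hf hR).sub ((isBlockTensor_gradTerm hV hf hR).add
    (isBlockTensor_hessTerm hV hf hR))).add (isBlockTensor_metricTerm hV hf hR)

theorem FieldEquations.isBlockTensor {κ : ℝ} {T : (DWIdx N → ℝ) → DWIdx N → DWIdx N → ℝ}
    (hκ : κ ≠ 0) (hT : S.FieldEquations f κ T) : S.IsBlockTensor T :=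
  (IsBlockTensor.smul (isRadialScalar_const κ⁻¹) (isBlockTensor_fieldLHS hV hf hR)).congr
    fun x hx i j => by rw [hT x hx, inv_mul_cancel_left₀ hκ]

end FieldEquations

end SphericalDW

/-! ### Hessian, curvature and field equations combined -/

theorem mainTheorem6 (N : ℕ) (hN : 1 ≤ N) (S : SphericalDW N)
    (hacc : ∀ x ∈ S.domain, S.acc x ≠ 0) :
    (∀ X : (DWIdx N → ℝ) → ℝ, ContDiffOn ℝ 2 X S.domain → S.IsPerfectTwoScalar X →
      S.IsPerfectTensor (S.hess X) ∧
      ∀ x ∈ S.domain, ∀ i j,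
        S.hess X x i j =
          -(S.dot X x * S.φ x) * S.metric x i j
          + S.u x i * S.u x j * (S.dot (S.dot X) x - S.φ x * S.dot X x - S.η x * S.tilde X x)
          - (S.acc x i * S.u x j + S.u x i * S.acc x j)
              * (S.tilde (S.dot X) x - S.φ x * S.tilde X x)
          + S.acc x i * S.acc x j
              * (S.tilde (S.tilde X) x + S.tilde X x * (S.accDeriv S.η x / (2 * S.η x ^ 2)))
          + S.proj x i j * S.tilde X x
              * ((-S.η x + S.divAcc x - S.accDeriv S.η x / (2 * S.η x)) / (N : ℝ))) ∧
    S.IsPerfectTwoScalar S.R ∧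
    S.IsPerfectTensor S.ric ∧
    S.IsPerfectTensor (S.hess S.R) ∧
    S.IsPerfectTensor (fun x i j => DWGeometry.grad S.R x i * DWGeometry.grad S.R x j) ∧
    ∀ (V : Set ℝ) (f : ℝ → ℝ), IsOpen V → ContDiffOn ℝ ∞ f V →
      (∀ x ∈ S.domain, S.R x ∈ V) →
      S.IsAnisotropicFluid (S.ricTerm f) ∧
      S.IsAnisotropicFluid (S.gradTerm f) ∧
      S.IsAnisotropicFluid (S.hessTerm f) ∧
      S.IsAnisotropicFluid (S.metricTerm f) ∧
      S.IsAnisotropicFluid (S.fieldLHS f) ∧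
      ∀ (κ : ℝ) (T : (DWIdx N → ℝ) → DWIdx N → DWIdx N → ℝ), κ ≠ 0 →
        S.FieldEquations f κ T → S.IsAnisotropicFluid T ∧ S.IsPerfectTensor T := by
  have hR := SphericalDW.isRadialScalar_R (S := S)
  refine ⟨fun X hC hX => ⟨hX.isPerfectTensor_hess hacc hC hN,
      fun x hx i j => hX.hess_eq hacc hC hx hN i j⟩,
    hR.isPerfectTwoScalar hacc, SphericalDW.isBlockTensor_ric.isPerfectTensor hacc,
    hR.hess.isPerfectTensor hacc, hR.grad_mul_grad.isPerfectTensor hacc,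
    fun V f hV hf hRV => ⟨?_, ?_, ?_, ?_, ?_, fun κ T hκ hT => ?_⟩⟩
  · exact (SphericalDW.isBlockTensor_ricTerm hV hf hRV).isAnisotropicFluid hacc
  · exact (SphericalDW.isBlockTensor_gradTerm hV hf hRV).isAnisotropicFluid hacc
  · exact (SphericalDW.isBlockTensor_hessTerm hV hf hRV).isAnisotropicFluid hacc
  · exact (SphericalDW.isBlockTensor_metricTerm hV hf hRV).isAnisotropicFluid hacc
  · exact (SphericalDW.isBlockTensor_fieldLHS hV hf hRV).isAnisotropicFluid hacc
  · have hB := SphericalDW.FieldEquations.isBlockTensor hV hf hRV hκ hT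
    exact ⟨hB.isAnisotropicFluid hacc, hB.isPerfectTensor hacc⟩
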